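/- Let $R\ge 1$, let $m_1,\dots,m_R$ be distinct positive integers and $\delta_1,\dots,\delta_R$ non-zero integers, and write, for $|q|<1$, $$G(q)=\prod_{r=1}^R (q^{m_r};q^{m_r})_\infty^{\delta_r}=\sum_{n\ge 0}g(n)q^n,\qquad (a;q)_\infty=\prod_{k\ge 0}(1-aq^k).$$ Put $L=\mathrm{lcm}(m_1,\dots,m_R)$, $\Delta_1=-\frac12\sum_r\delta_r$, $\Delta_2=\sum_r m_r\delta_r$, and for positive integers $k$ $$\Delta_3(k)=-\sum_{r=1}^R\frac{\delta_r\gcd(m_r,k)^2}{m_r},\qquad \Delta_4(k)=\prod_{r=1}^R\left(\frac{m_r}{\gcd(m_r,k)}\right)^{-\delta_r/2}.$$ For integers $0\le h<k$ with $\gcd(h,k)=1$ put $$\omega_{h,k}=\exp\left(-\pi i\sum_{r=1}^R\delta_r\, s\left(\frac{m_rh}{\gcd(m_r,k)},\frac{k}{\gcd(m_r,k)}\right)\right),\qquad s(d,c)=\sum_{n\bmod c}\left(\left(\frac{dn}{c}\right)\right)\left(\left(\frac nc\right)\right),$$ where $((x))=x-\lfloor x\rfloor-\frac12$ if $x\notin\mathbb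 Z$ and $((x))=0$ if $x\in\mathbb Z$. Let $I_s$ be the modified Bessel function of the first kind and $e(z)=e^{2\pi i z}$. **Theorem.** Assume that $\Delta_1\le 0$ and that $$\min_{1\le r\le R}\frac{\gcd(m_r,\ell)^2}{m_r}\ge\frac{\Delta_3(\ell)}{24}\qquad\text{for all }1\le\ell\le L.$$ Then for all positive integers $n>-\Delta_2/24$, $$g(n)=E(n)+\sum_{\substack{1\le\ell\le L\\ \Delta_3(\ell)>0}}2\pi\,\Delta_4(\ell)\left(\frac{24n+\Delta_2}{\Delta_3(\ell)}\right)^{-\frac{\Delta_1+1}{2}}\sum_{\substack{1\le k\le N\\ k\equiv \ell\,(\mathrm{mod}\,L)}}\frac{I_{-\Delta_1-1}\left(\frac{\pi}{6k}\sqrt{\Delta_3(\ell)(24n+\Delta_2)}\right)}{k}\sum_{\substack{0\le h<k\\ \gcd(h,k)=1}}\omega_{h,k}\,e\left(-\frac{nh}{k}\right),$$ where $N=\left\lfloor\sqrt{2\pi\left(n+\frac{\Delta_2}{24}\right)}\right\rfloor$ and, with $x=n+\frac{\Delta_2}{24}$ and a constant $C$ depending only on $(m_r)$ and $(\delta_r)$,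 $$|E(n)|\le C\cdot\begin{cases}1&\text{if }\Delta_1=0,\\ x^{1/4}&\text{if }\Delta_1=-\frac12,\\ x^{1/2}\log x&\text{if }\Delta_1=-1\text{ and }x>1,\\ 1&\text{if }\Delta_1=-1\text{ and }x\le 1,\\ x^{-\Delta_1-1/2}&\text{if }\Delta_1\le-\frac32.\end{cases}$$ -/

import Mathlib

namespace EtaQuotient

/-- The `q`-Pochhammer symbol `(a; q)_∞ = ∏_{k ≥ 0} (1 - a q ^ k)`. -/
noncomputable def qPochhammer (a q : ℂ) : ℂ := ∏' k : ℕ, (1 - a * q ^ k)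

/-- The function `G(q) = ∏_r (q ^ m_r; q ^ m_r)_∞ ^ δ_r` (meaningful for `|q| < 1`). -/
noncomputable def G {R : ℕ} (m : Fin R → ℕ) (δ : Fin R → ℤ) (q : ℂ) : ℂ :=
  ∏ r, qPochhammer (q ^ m r) (q ^ m r) ^ δ r

/-- The coefficient `g(n)` of `q ^ n` in the power series of `G` at the origin; see `hasSum_g`. -/
noncomputable def g {R : ℕ} (m : Fin R → ℕ) (δ : Fin R → ℤ) (n : ℕ) : ℂ :=
  (n.factorial : ℂ)⁻¹ * iteratedDeriv n (G m δ) 0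

lemma qPochhammer_self_eq (q : ℂ) : qPochhammer q q = ∏' k : ℕ, (1 - q ^ (k + 1)) := by
  simp only [qPochhammer, pow_succ']

lemma qPochhammer_self_ne_zero {q : ℂ} (hq : ‖q‖ < 1) : qPochhammer q q ≠ 0 := by
  rw [qPochhammer_self_eq]
  have h := tprod_one_add_ne_zero_of_summable (f := fun k : ℕ => -q ^ (k + 1)) (fun k => ?_) ?_
  · simpa [sub_eq_add_neg] using h
  · intro h0
    have h1 : q ^ (k + 1) = 1 := by linear_combination -h0
    have h2 : ‖q‖ ^ (k + 1) = 1 := by rw [← norm_pow, h1, norm_one]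
    exact (pow_lt_one₀ (norm_nonneg q) hq (Nat.succ_ne_zero k)).ne h2
  · simpa [pow_succ] using (summable_geometric_of_lt_one (norm_nonneg q) hq).mul_right ‖q‖

lemma norm_pow_lt_one {q : ℂ} (hq : ‖q‖ < 1) {m : ℕ} (hm : 0 < m) : ‖q ^ m‖ < 1 := by
  rw [norm_pow]; exact pow_lt_one₀ (norm_nonneg q) hq hm.ne'

lemma differentiableOn_G {R : ℕ} (m : Fin R → ℕ) (δ : Fin R → ℤ) (hm : ∀ r, 0 < m r) :
    DifferentiableOn ℂ (G m δ) (Metric.ball 0 1) := by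
  unfold G
  refine DifferentiableOn.fun_finsetProd fun r _ => ?_
  refine DifferentiableOn.zpow ?_ (Or.inl fun q hq => ?_)
  · have h : DifferentiableOn ℂ (fun q : ℂ => qPochhammer q q) (Metric.ball 0 1) := by
      simp only [qPochhammer_self_eq]
      exact ModularForm.differentiableOn_tprod_one_sub_pow
    refine h.comp (f := fun q : ℂ => q ^ m r) (by fun_prop) fun q hq => ?_
    simpa using norm_pow_lt_one (by simpa using hq) (hm r)
  · exact qPochhammer_self_ne_zero (norm_pow_lt_one (by simpa using hq) (hm r))

/-- `G(q) = ∑ g(n) q ^ n` on the open unit disk. -/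
theorem hasSum_g {R : ℕ} (m : Fin R → ℕ) (δ : Fin R → ℤ) (hm : ∀ r, 0 < m r)
    {q : ℂ} (hq : ‖q‖ < 1) : HasSum (fun n : ℕ => g m δ n * q ^ n) (G m δ q) := by
  have h := Complex.hasSum_taylorSeries_on_ball (c := 0) (r := 1) (z := q)
    (differentiableOn_G m δ hm) (by simpa using hq)
  have e : (fun n : ℕ => g m δ n * q ^ n) =
      fun n : ℕ => (n.factorial : ℂ)⁻¹ • (q - 0) ^ n • iteratedDeriv n (G m δ) 0 := by
    funext n
    simp only [g, sub_zero, smul_eq_mul]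
    ring
  rw [e]
  exact h

/-- `Δ₁ = -(1/2) ∑ δ_r`. -/
noncomputable def Delta1 {R : ℕ} (δ : Fin R → ℤ) : ℝ := -(1 / 2) * ∑ r, (δ r : ℝ)

/-- `Δ₂ = ∑ m_r δ_r`. -/
noncomputable def Delta2 {R : ℕ} (m : Fin R → ℕ) (δ : Fin R → ℤ) : ℝ :=
  ∑ r, (m r : ℝ) * (δ r : ℝ)

/-- `Δ₃(k) = -∑ δ_r gcd(m_r, k) ^ 2 / m_r`. -/
noncomputable def Delta3 {R : ℕ} (m : Fin R → ℕ) (δ : Fin R → ℤ) (k : ℕ) : ℝ :=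
  -∑ r, (δ r : ℝ) * ((m r).gcd k : ℝ) ^ 2 / (m r : ℝ)

/-- `Δ₄(k) = ∏ (m_r / gcd(m_r, k)) ^ (-δ_r / 2)`. -/
noncomputable def Delta4 {R : ℕ} (m : Fin R → ℕ) (δ : Fin R → ℤ) (k : ℕ) : ℝ :=
  ∏ r, ((m r : ℝ) / ((m r).gcd k : ℝ)) ^ (-(δ r : ℝ) / 2)

/-- `((x))`, equal to `x - ⌊x⌋ - 1/2` for non-integral `x` and to `0` for integral `x`. -/
noncomputable def sawtooth (x : ℝ) : ℝ :=
  if (⌊x⌋ : ℝ) = x then 0 else x - ⌊x⌋ - 1 / 2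

/-- The Dedekind sum `s(d, c) = ∑_{n mod c} ((d n / c)) ((n / c))`. -/
noncomputable def dedekindSum (d c : ℕ) : ℝ :=
  ∑ n ∈ Finset.range c, sawtooth ((d : ℝ) * n / c) * sawtooth ((n : ℝ) / c)

/-- `ω_{h,k} = exp (-π i ∑_r δ_r s(m_r h / gcd(m_r, k), k / gcd(m_r, k)))`.
Both natural-number divisions are exact. -/
noncomputable def omega {R : ℕ} (m : Fin R → ℕ) (δ : Fin R → ℤ) (h k : ℕ) : ℂ :=
  Complex.exp (-(Real.pi : ℂ) * Complex.I *
    ((∑ r, (δ r : ℝ) * dedekindSum (m r * h / (m r).gcd k) (k / (m r).gcd k) : ℝ) : ℂ))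

/-- `L = lcm(m_1, …, m_R)`. -/
def lcmL {R : ℕ} (m : Fin R → ℕ) : ℕ := Finset.univ.lcm m

/-- `{1 ≤ ℓ ≤ L : Δ₃(ℓ) > 0}`. -/
noncomputable def Lpos {R : ℕ} (m : Fin R → ℕ) (δ : Fin R → ℤ) : Finset ℕ :=
  open Classical in (Finset.Icc 1 (lcmL m)).filter fun ℓ => 0 < Delta3 m δ ℓ

/-- The modified Bessel function of the first kind
`I_s(x) = ∑_{j ≥ 0} (x / 2) ^ (2 j + s) / (j! Γ(j + s + 1))` for real order `s` and `x > 0`.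
As `Real.Gamma` vanishes at its poles and `0⁻¹ = 0`, the terms at the poles of `Γ` are `0`,
as they should be. -/
noncomputable def besselI (s x : ℝ) : ℝ :=
  ∑' j : ℕ, (x / 2) ^ (2 * (j : ℝ) + s) / ((j.factorial : ℝ) * Real.Gamma ((j : ℝ) + s + 1))

/-- The quantity `n + Δ₂ / 24`. -/
noncomputable def shifted {R : ℕ} (m : Fin R → ℕ) (δ : Fin R → ℤ) (n : ℕ) : ℝ :=
  (n : ℝ) + Delta2 m δ / 24

/-- `N = ⌊√(2π (n + Δ₂ / 24))⌋`. -/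
noncomputable def cutoff {R : ℕ} (m : Fin R → ℕ) (δ : Fin R → ℤ) (n : ℕ) : ℕ :=
  ⌊Real.sqrt (2 * Real.pi * shifted m δ n)⌋₊

/-- The sum `∑_{0 ≤ h < k, (h, k) = 1} ω_{h,k} e(-n h / k)`, where `e(z) = exp (2π i z)`. -/
noncomputable def kloostermanSum {R : ℕ} (m : Fin R → ℕ) (δ : Fin R → ℤ) (n k : ℕ) : ℂ :=
  ∑ h ∈ (Finset.range k).filter (fun h => Nat.gcd h k = 1),
    omega m δ h k * Complex.exp (2 * (Real.pi : ℂ) * Complex.I * (-((n : ℂ) * h / k)))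

/-- The main term of the asymptotic formula. -/
noncomputable def mainTerm {R : ℕ} (m : Fin R → ℕ) (δ : Fin R → ℤ) (n : ℕ) : ℂ :=
  ∑ ℓ ∈ Lpos m δ,
    ((2 * Real.pi * Delta4 m δ ℓ *
      ((24 * (n : ℝ) + Delta2 m δ) / Delta3 m δ ℓ) ^ (-((Delta1 δ + 1) / 2)) : ℝ) : ℂ) *
    ∑ k ∈ (Finset.Icc 1 (cutoff m δ n)).filter (fun k => k ≡ ℓ [MOD lcmL m]),
      ((besselI (-Delta1 δ - 1)
        (Real.pi / (6 * k) * Real.sqrt (Delta3 m δ ℓ * (24 * (n : ℝ) + Delta2 m δ))) / k : ℝ) : ℂ) *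
      kloostermanSum m δ n k

/-- The order of magnitude of the error term, as a function of `D = Δ₁` (a non-positive half
integer, so that the last case is `D ≤ -3/2`) and `x = n + Δ₂ / 24 > 0`.
For `D = -1` the quantity `x ^ (1/2) log x` is only positive for `x > 1`; at the finitely many
`n` with `x ≤ 1` it is replaced by `1`. -/
noncomputable def errorBound (D x : ℝ) : ℝ :=
  open Classical in
  if D = 0 then 1
  else if D = -1 / 2 then x ^ (1 / 4 : ℝ)
  else if D = -1 then (if 1 < x then x ^ (1 / 2 : ℝ) * Real.log x else 1)
  else x ^ (-D - 1 / 2)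

end EtaQuotient

/-! The proof is the circle method with a finite cutoff. By Cauchy's formula (`coeff_eq_integral`),
`g(n)` is the integral of `G(q) q^(-n)` over the circle `|q| = exp(-2πϱ)` with `ϱ = 1/N²`. At `q =
e((h + iz)/k)` the eta transformation (`eta_transform`, `G_transform`) turns `G` into an explicit
factor, `ω Δ₄ z^Δ₁ exp(π/(12k) (Δ₃/z + Δ₂ z))`, times an eta quotient in new nomes `q'_r` with
`|q'_r| = exp(-2π (gcd(m_r,k)²/m_r) Re(1/z)/k)`.

The factor `exp(πΔ₃/(12kz))` is large only if `Δ₃ > 0`. The hypothesis on the minimum says that each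
`|q'_r|` is then at most the reciprocal of its modulus. Since the new quotient is `1 + O(max
|q'_r|)`, replacing it by `1` costs only `O((kϱ)^Δ₁)` (`exists_local_bound`).

What remains near `h/k` is a truncated Hankel integral of `w^Δ₁ exp(Xw + A/w)`, whose completion is
a Bessel function. For `-1 ≤ Δ₁ ≤ 0` the complete integral does not converge absolutely. There the
estimate is deduced from larger exponents by integration by parts, which on the Bessel side is the
three-term recurrence (`exists_truncatedBound`).

The period is cut into intervals of radius `1/(2kN)` about the fractions with `k ≤ N`; the rest
lies, by Dirichlet, in annuli where the integrand is `O((kϱ)^Δ₁)` (`norm_integral_sub_sum_le`). The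
sums over `h` are estimated trivially, so the error is `O(N^(-Δ₁) + N^(-2Δ₁-1) ∑_{k ≤ N} k^Δ₁)`.
Inserting `N ≍ √x` produces the four cases of the bound. -/

open Finset

/-! ### Dedekind sums and their reciprocity law. -/

namespace EtaQuotient

/-- The Dedekind sum with an integral first argument. -/
noncomputable def dedekindSumInt (d : ℤ) (c : ℕ) : ℝ :=
  ∑ n ∈ range c, sawtooth ((d : ℝ) * n / c) * sawtooth ((n : ℝ) / c)

lemma dedekindSumInt_natCast (d c : ℕ) : dedekindSumInt d c = dedekindSum d c := by
  simp [dedekindSumInt, dedekindSum]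

lemma sawtooth_add_intCast (x : ℝ) (j : ℤ) : sawtooth (x + j) = sawtooth x := by
  simp only [sawtooth, Int.floor_add_intCast, Int.cast_add, add_left_inj, add_sub_add_right_eq_sub]

lemma sawtooth_of_mem_Ioo {x : ℝ} (h0 : 0 < x) (h1 : x < 1) : sawtooth x = x - 1 / 2 := by
  have : ⌊x⌋ = 0 := Int.floor_eq_iff.2 ⟨by simpa using h0.le, by simpa using h1⟩
  simp [sawtooth, this, h0.ne]

lemma sawtooth_neg (x : ℝ) : sawtooth (-x) = -sawtooth x := by
  have key : ∀ y : ℝ, sawtooth y = if Int.fract y = 0 then 0 else Int.fract y - 1 / 2 := by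
    intro y
    have : (⌊y⌋ : ℝ) = y ↔ Int.fract y = 0 := by
      rw [Int.fract, sub_eq_zero, eq_comm]
    simp only [sawtooth, this]
    rfl
  rw [key, key]
  by_cases hx : Int.fract x = 0
  · have : Int.fract (-x) = 0 := by rwa [Int.fract_neg_eq_zero]
    simp [hx, this]
  · have h2 : Int.fract (-x) ≠ 0 := by rwa [Ne, Int.fract_neg_eq_zero]
    rw [if_neg hx, if_neg h2, Int.fract_neg hx]; ring

lemma dedekindSumInt_neg (d : ℤ) (c : ℕ) : dedekindSumInt (-d) c = -dedekindSumInt d c := by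
  simp only [dedekindSumInt, ← sum_neg_distrib]
  refine sum_congr rfl fun n _ => ?_
  rw [show ((-d : ℤ) : ℝ) * n / c = -((d : ℝ) * n / c) by push_cast; ring, sawtooth_neg, neg_mul]

lemma dedekindSumInt_add_mul (d j : ℤ) {c : ℕ} (hc : 0 < c) :
    dedekindSumInt (d + j * c) c = dedekindSumInt d c := by
  simp only [dedekindSumInt]
  refine sum_congr rfl fun n _ => ?_
  rw [show ((d + j * c : ℤ) : ℝ) * n / c = (d : ℝ) * n / c + ((j * n : ℤ) : ℝ) by
    push_cast; field_simp, sawtooth_add_intCast]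

/-- Multiplication by a unit permutes the residues modulo `k`. -/
lemma sum_mul_mod {h k : ℕ} (hk : 0 < k) (hc : Nat.Coprime h k) (F : ℕ → ℝ) :
    ∑ n ∈ range k, F (h * n % k) = ∑ n ∈ range k, F n := by
  have hinj : Set.InjOn (fun n => h * n % k) (range k : Set ℕ) := by
    intro a ha b hb hab
    have := Nat.ModEq.cancel_left_of_coprime (c := h) (by simpa [Nat.coprime_comm] using hc)
      (show h * a ≡ h * b [MOD k] from hab)
    simp only [coe_range, Set.mem_Iio] at ha hb
    exact Nat.ModEq.eq_of_lt_of_lt this ha hb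
  have himg : (range k).image (fun n => h * n % k) = range k := by
    refine eq_of_subset_of_card_le (fun x hx => ?_) (by rw [card_image_of_injOn hinj])
    obtain ⟨n, -, rfl⟩ := mem_image.1 hx
    exact mem_range.2 (Nat.mod_lt _ hk)
  rw [← sum_image (f := F) hinj, himg]

lemma sum_range_sq (k : ℕ) : ∑ n ∈ range k, (n : ℝ) ^ 2 = (k - 1) * k * (2 * k - 1) / 6 := by
  induction k with
  | zero => simp
  | succ k ih => rw [sum_range_succ, ih]; push_cast; ring

lemma sum_range_cast (k : ℕ) : ∑ n ∈ range k, (n : ℝ) = (k - 1) * k / 2 := by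
  induction k with
  | zero => simp
  | succ k ih => rw [sum_range_succ, ih]; push_cast; ring

lemma cast_mul_mod_div (h n k : ℕ) :
    ((h * n % k : ℕ) : ℝ) = h * n - k * ((h * n / k : ℕ) : ℝ) := by
  have := Nat.div_add_mod (h * n) k
  rw [eq_sub_iff_add_eq, add_comm]; exact_mod_cast this

lemma sum_floor {h k : ℕ} (hk : 0 < k) (hc : Nat.Coprime h k) :
    ∑ n ∈ range k, ((h * n / k : ℕ) : ℝ) = (h - 1) * (k - 1) / 2 := by
  have h1 := sum_mul_mod hk hc (fun n => (n : ℝ))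
  simp only [cast_mul_mod_div h _ k, sum_sub_distrib, ← mul_sum, sum_range_cast] at h1
  have : (k : ℝ) ≠ 0 := by positivity
  field_simp
  apply mul_left_cancel₀ this
  linear_combination (-2) * h1

/-- Comes from summing the squares of the permuted residues `hn - k⌊hn/k⌋`. It ties the mixed sum in
the Dedekind sum to `∑ ⌊hn/k⌋²`. -/
lemma sum_floor_sq {h k : ℕ} (hk : 0 < k) (hc : Nat.Coprime h k) :
    (h ^ 2 - 1) * ((k - 1) * k * (2 * k - 1) / 6) -
      2 * h * k * ∑ n ∈ range k, (n : ℝ) * ((h * n / k : ℕ) : ℝ)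
      + k ^ 2 * ∑ n ∈ range k, ((h * n / k : ℕ) : ℝ) ^ 2 = 0 := by
  have h1 := sum_mul_mod hk hc (fun n => (n : ℝ) ^ 2)
  rw [sum_range_sq] at h1
  have h2 : ∑ n ∈ range k, ((h * n % k : ℕ) : ℝ) ^ 2 = h ^ 2 * ∑ n ∈ range k, (n : ℝ) ^ 2
      - 2 * h * k * ∑ n ∈ range k, (n : ℝ) * ((h * n / k : ℕ) : ℝ)
      + k ^ 2 * ∑ n ∈ range k, ((h * n / k : ℕ) : ℝ) ^ 2 := by
    rw [mul_sum, mul_sum, mul_sum, ← sum_sub_distrib, ← sum_add_distrib]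
    refine sum_congr rfl fun n _ => ?_
    rw [cast_mul_mod_div h _ k]; ring
  rw [h2, sum_range_sq] at h1
  linear_combination h1

lemma sum_range_two_mul (f : ℕ) : ∑ j ∈ range (f + 1), 2 * (j : ℝ) = f ^ 2 + f := by
  rw [← mul_sum, sum_range_cast]; push_cast; ring

/-- Lattice points of a rectangle are counted on both sides of the diagonal `hn = jk`, with weight
`2j`: since `f² + f = ∑_{j ≤ f} 2j`, the first sum collects the points with `jk ≤ hn`, the second
those with `hn ≤ jk`. -/
lemma sum_lattice {h k : ℕ} (hh : 0 < h) (hk : 0 < k) (hc : Nat.Coprime h k) :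
    ∑ n ∈ range k, (((h * n / k : ℕ) : ℝ) ^ 2 + ((h * n / k : ℕ) : ℝ)) +
      2 * ∑ j ∈ range h, (j : ℝ) * ((k * j / h : ℕ) : ℝ) = (k - 1) * h * (h - 1) := by
  have h1 : ∀ n ∈ range k, ((h * n / k : ℕ) : ℝ) ^ 2 + ((h * n / k : ℕ) : ℝ) =
      ∑ j ∈ range h, if j * k ≤ h * n then 2 * (j : ℝ) else 0 := by
    intro n hn
    rw [← sum_range_two_mul, ← sum_filter]
    refine sum_congr ?_ fun _ _ => rfl
    ext j
    have hlt : h * n / k < h := by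
      rw [Nat.div_lt_iff_lt_mul hk]; exact Nat.mul_lt_mul_of_pos_left (mem_range.1 hn) hh
    simp only [mem_range, mem_filter, Nat.lt_succ_iff, Nat.le_div_iff_mul_le hk]
    refine ⟨fun hj => ⟨lt_of_le_of_lt ((Nat.le_div_iff_mul_le hk).2 hj) hlt, hj⟩, fun hj => hj.2⟩
  have h2 : ∀ j ∈ range h, (j : ℝ) * ((k * j / h : ℕ) : ℝ) =
      ∑ n ∈ range k, if 0 < n ∧ h * n ≤ j * k then (j : ℝ) else 0 := by
    intro j hj
    have hlt : k * j / h < k := by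
      rw [Nat.div_lt_iff_lt_mul hh]; exact Nat.mul_lt_mul_of_pos_left (mem_range.1 hj) hk
    rw [← sum_filter, sum_const, nsmul_eq_mul, mul_comm]
    congr 2
    have : (range k).filter (fun n => 0 < n ∧ h * n ≤ j * k) = Ioc 0 (k * j / h) := by
      ext n
      simp only [mem_range, mem_filter, mem_Ioc, Nat.le_div_iff_mul_le hh]
      constructor
      · rintro ⟨_, h0, h1⟩; exact ⟨h0, by linarith⟩
      · rintro ⟨h0, h1⟩
        exact ⟨lt_of_le_of_lt ((Nat.le_div_iff_mul_le hh).2 h1) hlt, h0, by linarith⟩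
    rw [this]; simp
  rw [sum_congr rfl h1, sum_congr rfl h2, mul_sum, sum_comm, ← sum_add_distrib]
  have h3 : ∀ j ∈ range h, (∑ n ∈ range k, if j * k ≤ h * n then 2 * (j : ℝ) else 0) +
      2 * (∑ n ∈ range k, if 0 < n ∧ h * n ≤ j * k then (j : ℝ) else 0) =
        2 * (j : ℝ) * (k - 1) := by
    intro j hj
    rw [mul_sum, ← sum_add_distrib]
    obtain ⟨k, rfl⟩ : ∃ l, k = l + 1 := ⟨k - 1, by omega⟩
    rw [sum_range_succ']
    rcases Nat.eq_zero_or_pos j with rfl | hj0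
    · simp
    have h5 : ∀ n ∈ range k, ((if j * (k + 1) ≤ h * (n + 1) then 2 * (j : ℝ) else 0) +
        2 * (if 0 < n + 1 ∧ h * (n + 1) ≤ j * (k + 1) then (j : ℝ) else 0)) = 2 * j := by
      intro n hn
      -- By coprimality no interior lattice point lies on the diagonal, so each is counted exactly
      -- once.
      have hne : h * (n + 1) ≠ j * (k + 1) := by
        intro he
        have : (k + 1) ∣ (n + 1) :=
          Nat.Coprime.dvd_of_dvd_mul_left (Nat.coprime_comm.1 hc) (he ▸ dvd_mul_left _ _)
        have := Nat.le_of_dvd (by omega) this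
        have := mem_range.1 hn
        omega
      rcases lt_or_gt_of_ne hne with hlt | hlt
      · rw [if_neg (by omega), if_pos ⟨by omega, hlt.le⟩]; ring
      · rw [if_pos hlt.le, if_neg (by omega)]; ring
    rw [sum_congr rfl h5]
    simp [hj0.ne']; ring
  rw [sum_congr rfl h3, ← sum_mul, ← mul_sum, sum_range_cast]
  ring

/-- For `0 < n < k` both sawtooth arguments are non-integral, so each is its fractional part minus
`1/2`. At `n = 0` that formula would give `1/4` instead of `0`, hence the correction term below. -/
lemma dedekindSum_eq {h k : ℕ} (hk : 0 < k) (hc : Nat.Coprime h k) :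
    dedekindSum h k = h / (k : ℝ) ^ 2 * ((k - 1) * k * (2 * k - 1) / 6)
      - (∑ n ∈ range k, (n : ℝ) * ((h * n / k : ℕ) : ℝ)) / k - (k - 1) / 4 := by
  have hk' : (k : ℝ) ≠ 0 := by positivity
  have h1 : ∀ n ∈ range k, sawtooth ((h : ℝ) * n / k) * sawtooth ((n : ℝ) / k) =
      ((h : ℝ) * n / k - (h * n / k : ℕ) - 1 / 2) * ((n : ℝ) / k) - 1 / 2 *
        ((h : ℝ) * n / k - (h * n / k : ℕ) - 1 / 2) - (if n = 0 then 1 / 4 else 0) := by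
    intro n hn
    rcases Nat.eq_zero_or_pos n with rfl | hn0
    · simp [sawtooth]; norm_num
    have hnk := mem_range.1 hn
    have hmod : h * n % k ≠ 0 := fun h0 => by
      have : k ∣ n := Nat.Coprime.dvd_of_dvd_mul_left (Nat.coprime_comm.1 hc)
        (Nat.dvd_of_mod_eq_zero h0)
      exact absurd (Nat.le_of_dvd hn0 this) (by omega)
    have e : (h : ℝ) * n / k = ((h * n % k : ℕ) : ℝ) / k + (((h * n / k : ℕ) : ℤ) : ℝ) := by
      rw [cast_mul_mod_div h n k, Int.cast_natCast]; field_simp; ring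
    have hkpos : (0 : ℝ) < k := by positivity
    have e1 : sawtooth ((h : ℝ) * n / k) = (h : ℝ) * n / k - (h * n / k : ℕ) - 1 / 2 := by
      rw [e, sawtooth_add_intCast, sawtooth_of_mem_Ioo]
      · rw [Int.cast_natCast]; ring
      · have : 0 < h * n % k := by omega
        positivity
      · rw [div_lt_one hkpos]; exact_mod_cast Nat.mod_lt _ hk
    have e2 : sawtooth ((n : ℝ) / k) = n / k - 1 / 2 :=
      sawtooth_of_mem_Ioo (by positivity) (by rw [div_lt_one hkpos]; exact_mod_cast hnk)
    rw [e1, e2, if_neg (by omega)]; ring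
  have h2 : ∑ n ∈ range k, (if n = 0 then (1 / 4 : ℝ) else 0) = 1 / 4 := by
    rw [sum_ite_eq' (range k) 0 (fun _ => (1 / 4 : ℝ)), if_pos (mem_range.2 hk)]
  have h3 : ∑ n ∈ range k, ((h : ℝ) * n / k - (h * n / k : ℕ) - 1 / 2) = -(1 / 2) := by
    simp only [sum_sub_distrib, mul_div_assoc, ← mul_sum, ← sum_div, sum_range_cast,
      sum_floor hk hc, sum_const, card_range, nsmul_eq_mul]
    field_simp; ring
  have h4 : ∑ n ∈ range k, ((h : ℝ) * n / k - (h * n / k : ℕ) - 1 / 2) * ((n : ℝ) / k) =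
      h / (k : ℝ) ^ 2 * ∑ n ∈ range k, (n : ℝ) ^ 2
      - (∑ n ∈ range k, (n : ℝ) * ((h * n / k : ℕ) : ℝ)) / k -
        (∑ n ∈ range k, (n : ℝ)) / (2 * k) := by
    rw [mul_sum, sum_div, sum_div, ← sum_sub_distrib, ← sum_sub_distrib]
    refine sum_congr rfl fun n _ => ?_
    field_simp
  rw [dedekindSum, sum_congr rfl h1, sum_sub_distrib, sum_sub_distrib, h2, h4, ← mul_sum, h3,
    sum_range_sq, sum_range_cast]
  field_simp; ring

/-- Reciprocity for Dedekind sums. -/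
theorem dedekindSum_add_dedekindSum {h k : ℕ} (hh : 0 < h) (hk : 0 < k) (hc : Nat.Coprime h k) :
    dedekindSum h k + dedekindSum k h =
      -1 / 4 + ((h : ℝ) / k + k / h + 1 / (h * k)) / 12 := by
  have h1 := sum_floor_sq hk hc
  have h2 := sum_lattice hh hk hc
  rw [sum_add_distrib, sum_floor hk hc] at h2
  rw [dedekindSum_eq hk hc, dedekindSum_eq hh (Nat.coprime_comm.1 hc)]
  have hk' : (k : ℝ) ≠ 0 := by positivity
  have hh' : (h : ℝ) ≠ 0 := by positivity
  generalize ∑ n ∈ range k, (n : ℝ) * ((h * n / k : ℕ) : ℝ) = A at *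
  generalize ∑ n ∈ range h, (n : ℝ) * ((k * n / h : ℕ) : ℝ) = B at *
  generalize ∑ n ∈ range k, ((h * n / k : ℕ) : ℝ) ^ 2 = Q at *
  -- `A` and `B` are both expressed through `Q`, which cancels in `A/k + B/h`.
  have hA : A = (((h : ℝ) ^ 2 - 1) * ((k - 1) * k * (2 * k - 1) / 6) + k ^ 2 * Q) / (2 * h * k) := by
    rw [eq_div_iff (by positivity)]; linear_combination -h1
  have hB : B = ((k - 1) * h * (h - 1) - Q - (h - 1) * (k - 1) / 2) / 2 := by
    linear_combination h2 / 2
  rw [hA, hB]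
  field_simp
  ring

end EtaQuotient

/-! ### The transformation law of the eta function, with Dedekind sums as multiplier. -/

namespace EtaQuotient

open Complex in
lemma mul_cpow_of_arg_add_mem {x y : ℂ} (hx : x ≠ 0) (hy : y ≠ 0)
    (h : x.arg + y.arg ∈ Set.Ioc (-Real.pi) Real.pi) (s : ℂ) : (x * y) ^ s = x ^ s * y ^ s := by
  rw [cpow_def_of_ne_zero (mul_ne_zero hx hy), cpow_def_of_ne_zero hx, cpow_def_of_ne_zero hy,
    (log_mul_eq_add_log_iff hx hy).2 h, ← exp_add, add_mul]

lemma ne_zero_of_re_pos {z : ℂ} (hz : 0 < z.re) : z ≠ 0 := by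
  rintro rfl; simp at hz

lemma abs_arg_lt_of_re_pos {z : ℂ} (hz : 0 < z.re) : |z.arg| < Real.pi / 2 :=
  Complex.abs_arg_lt_pi_div_two_iff.2 (Or.inl hz)

lemma re_inv_pos {z : ℂ} (hz : 0 < z.re) : 0 < (z⁻¹).re := by
  rw [Complex.inv_re]
  exact div_pos hz (Complex.normSq_pos.2 (ne_zero_of_re_pos hz))

open Complex in
lemma eta_add_intCast (z : ℂ) (j : ℤ) :
    ModularForm.eta (z + j) = exp (Real.pi * I * j / 12) * ModularForm.eta z := by
  simp only [ModularForm.eta, ModularForm.eta_q_eq_pow, Function.Periodic.qParam]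
  rw [show 2 * (Real.pi : ℂ) * I * (z + j) = 2 * Real.pi * I * z + j * (2 * Real.pi * I) by ring,
    exp_periodic.int_mul, add_div, exp_add,
    show (j : ℂ) * (2 * Real.pi * I) / ((24 : ℝ) : ℂ) = Real.pi * I * j / 12 by push_cast; ring]
  ring

open Complex in
lemma eta_I_mul {w : ℂ} (hw : 0 < w.re) :
    ModularForm.eta (I * w) = w ^ (-(1 / 2) : ℂ) * ModularForm.eta (I / w) := by
  have hw0 := ne_zero_of_re_pos hw
  have hinv := re_inv_pos hw
  have h1 : I / w ∈ UpperHalfPlane.upperHalfPlaneSet := by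
    simpa [UpperHalfPlane.upperHalfPlaneSet, div_eq_mul_inv] using hinv
  have h2 := ModularForm.eta_comp_eq_csqrt_I_inv h1
  have h3 : (-1 : ℂ) / (I / w) = I * w := by
    field_simp; rw [I_sq]
  simp only [Function.comp_apply, h3, Pi.smul_apply, Pi.mul_apply, smul_eq_mul, Complex.sqrt] at h2
  have h4 : (I / w) ^ (2⁻¹ : ℂ) = I ^ (2⁻¹ : ℂ) * w ^ (-(1 / 2) : ℂ) := by
    rw [div_eq_mul_inv, mul_cpow_of_arg_add_mem I_ne_zero (inv_ne_zero hw0),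
      inv_cpow _ _ (by have := abs_lt.1 (abs_arg_lt_of_re_pos hw); linarith), ← cpow_neg]
    · norm_num
    · have := abs_lt.1 (abs_arg_lt_of_re_pos hinv)
      rw [arg_I]
      constructor <;> linarith
  rw [h2, h4, ← mul_assoc, ← mul_assoc, inv_mul_cancel₀, one_mul]
  rw [cpow_ne_zero_iff]; left; exact I_ne_zero

open Complex in
/-- The transformation law of the Dedekind eta function between two cusps. -/
theorem eta_transform (k : ℕ) (hk : 0 < k) : ∀ (h h' : ℤ), (k : ℤ) ∣ h * h' + 1 →
    ∀ z : ℂ, 0 < z.re → ModularForm.eta ((h + I * z) / k) =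
      exp (Real.pi * I * (((h : ℝ) - h') / (12 * k) - dedekindSumInt h k : ℝ)) *
        z ^ (-(1 / 2) : ℂ) * ModularForm.eta ((h' + I / z) / k) := by
  -- Euclid's algorithm: translate `h` to its residue `r` modulo `k`, invert, and use the law for
  -- the smaller denominator `r`. Reciprocity says that the claimed multiplier obeys the same
  -- recursion.
  induction k using Nat.strong_induction_on with
  | _ k ih =>
  intro h h' hh z hz
  have hz0 := ne_zero_of_re_pos hz
  have hkC : (k : ℂ) ≠ 0 := by exact_mod_cast hk.ne'
  rcases Nat.lt_or_ge 1 k with hk1 | hk1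
  swap
  · obtain rfl : k = 1 := by omega
    have h0 : dedekindSumInt h 1 = 0 := by simp [dedekindSumInt, sawtooth]
    rw [h0, show (h + I * z) / ((1 : ℕ) : ℂ) = I * z + h by push_cast; ring,
      show (h' + I / z) / ((1 : ℕ) : ℂ) = I / z + h' by push_cast; ring,
      eta_add_intCast, eta_add_intCast, eta_I_mul hz]
    have : exp (Real.pi * I * h / 12) = exp (Real.pi * I *
        ((((h : ℝ) - h') / (12 * (1 : ℕ)) - 0 : ℝ) : ℂ)) * exp (Real.pi * I * h' / 12) := by
      rw [← exp_add]; congr 1; push_cast; ring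
    rw [this]; ring
  obtain ⟨r, j, hr0, hrk, hrj⟩ : ∃ (r : ℕ) (j : ℤ), 0 < r ∧ r < k ∧ h = r + j * k := by
    have hkz : (0 : ℤ) < k := by exact_mod_cast hk
    have h1 := Int.emod_nonneg h hkz.ne'
    have h2 := Int.emod_lt_of_pos h hkz
    have h3 := Int.emod_add_mul_ediv h k
    refine ⟨(h % k).toNat, h / k, ?_, by omega, ?_⟩
    · rcases h1.lt_or_eq with h4 | h4
      · omega
      · exfalso
        have h5 : (k : ℤ) ∣ h := Int.dvd_of_emod_eq_zero h4.symm
        have h6 : (k : ℤ) ∣ 1 := by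
          have := dvd_sub hh (h5.mul_right h')
          simpa using this
        have := Int.le_of_dvd one_pos h6
        omega
    · rw [Int.toNat_of_nonneg h1]; linarith
  have hrC : (r : ℂ) ≠ 0 := by exact_mod_cast hr0.ne'
  have hrh : (k : ℤ) ∣ r * h' + 1 := by
    have : (r : ℤ) * h' + 1 = h * h' + 1 - k * (j * h') := by rw [hrj]; ring
    rw [this]; exact dvd_sub hh (dvd_mul_right _ _)
  obtain ⟨h1, hh1⟩ := hrh
  have hcop : Nat.Coprime r k := by
    rw [← Nat.isCoprime_iff_coprime]
    exact ⟨-h', h1, by linarith⟩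
  -- the inversion of the point `(r + I z) / k`
  set w : ℂ := (z - I * r) / k with hw
  set z₁ : ℂ := k * z / (r + I * z) with hz₁
  have hwre : 0 < w.re := by
    rw [hw, div_natCast_re]
    simp only [sub_re, mul_re, I_re, natCast_re, I_im, natCast_im]
    have : (0 : ℝ) < k := by exact_mod_cast hk
    have : z.re - (0 * r - 1 * 0) = z.re := by ring
    rw [this]; positivity
  have hw0 := ne_zero_of_re_pos hwre
  have hrz : (r : ℂ) + I * z ≠ 0 := by
    intro h0
    apply hw0
    have : z - I * r = -I * (r + I * z) := by linear_combination z * I_sq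
    rw [hw, this, h0]; simp
  have hz₁inv : z₁⁻¹ = (r * z⁻¹ + I) / k := by
    rw [hz₁]; field_simp
  have hz₁re : 0 < z₁.re := by
    have : 0 < (z₁⁻¹).re := by
      rw [hz₁inv, div_natCast_re]
      have h2 : (0 : ℝ) < k := by exact_mod_cast hk
      have h3 : (0 : ℝ) < r := by exact_mod_cast hr0
      have h4 := re_inv_pos hz
      simp only [add_re, mul_re, natCast_re, natCast_im, I_re, zero_mul, sub_zero, add_zero]
      positivity
    simpa using re_inv_pos this
  have hz₁0 := ne_zero_of_re_pos hz₁re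
  -- As `r h' + 1 = k h1`, the pair `(-k, h1)` satisfies the congruence modulo `r`.
  have hIH := ih r hrk hr0 (-k) h1 ⟨-h', by linarith⟩ z₁ hz₁re
  have e1 : (h + I * z) / k = I * w + j := by
    rw [hrj, hw]; push_cast; field_simp; linear_combination (r : ℂ) * I_sq
  have e2 : I / w = ((-k : ℤ) + I * z₁) / r := by
    rw [div_eq_iff hw0, hw, hz₁]; push_cast; field_simp
    linear_combination (r * z) * I_sq
  have e3 : (h1 + I / z₁) / r = (h' + I / z) / k := by
    have : (r : ℂ) * h' + 1 = k * h1 := by exact_mod_cast hh1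
    rw [div_eq_mul_inv I z₁, hz₁inv]; field_simp
    linear_combination (-z) * this + z * I_sq
  -- The arguments of `w`, `z₁` and `z` lie in `(-π/2, π/2)`, so the principal powers multiply
  -- without a branch jump. The eighth root of unity is `(-i)^(-1/2)`, from `w z₁ = -iz`; it offsets
  -- the `-1/4` in reciprocity.
  have e4 : w ^ (-(1 / 2) : ℂ) * z₁ ^ (-(1 / 2) : ℂ) =
      exp (Real.pi * I / 4) * z ^ (-(1 / 2) : ℂ) := by
    have a1 := abs_lt.1 (abs_arg_lt_of_re_pos hwre)
    have a2 := abs_lt.1 (abs_arg_lt_of_re_pos hz₁re)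
    have a3 := abs_lt.1 (abs_arg_lt_of_re_pos hz)
    rw [← mul_cpow_of_arg_add_mem hw0 hz₁0 ⟨by linarith, by linarith⟩]
    have : w * z₁ = -I * z := by
      rw [hw, hz₁, div_mul_div_comm, div_eq_iff (mul_ne_zero hkC hrz)]
      linear_combination (k * z ^ 2) * I_sq
    rw [this, mul_cpow_of_arg_add_mem (neg_ne_zero.2 I_ne_zero) hz0
      (by rw [arg_neg_I]; exact ⟨by linarith, by linarith [Real.pi_pos]⟩)]
    congr 1
    rw [cpow_def_of_ne_zero (neg_ne_zero.2 I_ne_zero), log_neg_I]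
    congr 1; ring
  have hs : dedekindSumInt h k = dedekindSum r k := by
    rw [hrj, dedekindSumInt_add_mul _ _ hk, dedekindSumInt_natCast]
  have hs' : dedekindSumInt (-k) r = -dedekindSum k r := by
    rw [dedekindSumInt_neg, dedekindSumInt_natCast]
  have hrec := dedekindSum_add_dedekindSum hr0 hk hcop
  rw [e1, eta_add_intCast, eta_I_mul hwre, e2, hIH, e3, hs, hs']
  have e5 : exp (Real.pi * I * j / 12) * exp (Real.pi * I / 4) *
      exp (Real.pi * I * ((((-k : ℤ) : ℝ) - h1) / (12 * r) - -dedekindSum k r : ℝ)) =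
      exp (Real.pi * I * (((h : ℝ) - h') / (12 * k) - dedekindSum r k : ℝ)) := by
    rw [← exp_add, ← exp_add]
    congr 1
    have hkR : (k : ℝ) ≠ 0 := by exact_mod_cast hk.ne'
    have hrR : (r : ℝ) ≠ 0 := by exact_mod_cast hr0.ne'
    have h6 : (r : ℝ) * h' + 1 = k * h1 := by exact_mod_cast hh1
    have h7 : (j : ℝ) / 12 + 1 / 4 + ((((-k : ℤ) : ℝ) - h1) / (12 * r) - -dedekindSum k r) =
        ((h : ℝ) - h') / (12 * k) - dedekindSum r k := by
      have h8 : dedekindSum k r = -1 / 4 + ((r : ℝ) / k + k / r + 1 / (r * k)) / 12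
        - dedekindSum r k := by linarith
      rw [h8, hrj]; push_cast; field_simp
      linear_combination 4 * h6
    rw [← h7]; push_cast; ring
  rw [← e5]
  linear_combination (exp (Real.pi * I * j / 12) *
    exp (Real.pi * I * ((((-k : ℤ) : ℝ) - h1) / (12 * r) - -dedekindSum k r : ℝ)) *
    ModularForm.eta ((h' + I / z) / k)) * e4

end EtaQuotient

/-! ### Behaviour of the eta quotient at the cusps. -/

namespace EtaQuotient

open Complex

lemma eta_eq_qPochhammer (τ : ℂ) : ModularForm.eta τ =
    exp (2 * Real.pi * I * τ / 24) *
      qPochhammer (exp (2 * Real.pi * I * τ)) (exp (2 * Real.pi * I * τ)) := by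
  simp only [ModularForm.eta, ModularForm.eta_q_eq_pow, Function.Periodic.qParam,
    qPochhammer_self_eq]
  push_cast; rfl

/-- This is `eta_transform` with the factors `exp(2πiτ/24)` moved to one side, where they combine to
`exp(π/(12c) (z - 1/z))`. Later arguments use only the size of the new nome, so it is kept
existential. -/
lemma qPochhammer_transform {d c : ℕ} (hc : 0 < c) (hdc : Nat.Coprime d c) {z : ℂ}
    (hz : 0 < z.re) : ∃ q' : ℂ, ‖q'‖ = Real.exp (-2 * Real.pi * ((z⁻¹).re / c)) ∧
      qPochhammer (exp (2 * Real.pi * I * ((d + I * z) / c)))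
        (exp (2 * Real.pi * I * ((d + I * z) / c))) =
      exp (-Real.pi * I * dedekindSum d c) * z ^ (-(1 / 2) : ℂ) *
        exp (Real.pi / (12 * c) * (z - z⁻¹)) * qPochhammer q' q' := by
  obtain ⟨u, v, huv⟩ := Nat.isCoprime_iff_coprime.2 hdc
  have hz0 := ne_zero_of_re_pos hz
  have hcC : (c : ℂ) ≠ 0 := by exact_mod_cast hc.ne'
  have h1 := eta_transform c hc d (-u) ⟨v, by linarith⟩ z hz
  rw [eta_eq_qPochhammer, eta_eq_qPochhammer, dedekindSumInt_natCast] at h1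
  refine ⟨exp (2 * Real.pi * I * (((-u : ℤ) + I / z) / c)), ?_, ?_⟩
  · rw [norm_exp]
    congr 1
    have : 2 * (Real.pi : ℂ) * I * (((-u : ℤ) + I / z) / c) =
        ((-2 * Real.pi / c : ℝ) : ℂ) * z⁻¹ + ((-2 * Real.pi * u / c : ℝ) : ℂ) * I := by
      push_cast
      linear_combination (2 * Real.pi * z⁻¹ / c) * I_sq
    rw [this, add_re, re_ofReal_mul, re_ofReal_mul, I_re]; ring
  · have h2 : exp (2 * Real.pi * I * ((d + I * z) / c) / 24) ≠ 0 := exp_ne_zero _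
    apply mul_left_cancel₀ h2
    have h3 : exp (2 * Real.pi * I * ((d + I * z) / c) / 24) *
        (exp (-Real.pi * I * dedekindSum d c) * exp (Real.pi / (12 * c) * (z - z⁻¹))) =
        exp (Real.pi * I * ((((d : ℤ) : ℝ) - (-u : ℤ)) / (12 * c) - dedekindSum d c : ℝ)) *
        exp (2 * Real.pi * I * (((-u : ℤ) + I / z) / c) / 24) := by
      rw [← exp_add, ← exp_add, ← exp_add]
      congr 1
      push_cast; field_simp
      linear_combination (24 * (z ^ 2 - 1)) * I_sq
    rw [Int.cast_natCast] at h1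
    rw [h1]
    linear_combination (-(z ^ (-(1 / 2) : ℂ)) * qPochhammer
      (exp (2 * Real.pi * I * (((-u : ℤ) + I / z) / c)))
      (exp (2 * Real.pi * I * (((-u : ℤ) + I / z) / c)))) * h3

lemma ofReal_mul_cpow {x : ℝ} (hx : 0 < x) {z : ℂ} (hz : 0 < z.re) (s : ℂ) :
    ((x : ℂ) * z) ^ s = (x : ℂ) ^ s * z ^ s := by
  refine mul_cpow_of_arg_add_mem (by exact_mod_cast hx.ne') (ne_zero_of_re_pos hz) ?_ s
  rw [arg_ofReal_of_nonneg hx.le, zero_add]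
  exact ⟨neg_pi_lt_arg z, arg_le_pi z⟩

/-- The behaviour of one factor of the eta quotient near the cusp `h / k`. -/
lemma qPochhammer_pow_transform {M : ℕ} (hM : 0 < M) (e : ℤ) {h k : ℕ} (hk : 0 < k)
    (hc : Nat.Coprime h k) {z : ℂ} (hz : 0 < z.re) :
    ∃ q' : ℂ, ‖q'‖ = Real.exp (-2 * Real.pi * ((M.gcd k : ℝ) ^ 2 / M) * ((z⁻¹).re / k)) ∧
      qPochhammer (exp (2 * Real.pi * I * ((h + I * z) / k)) ^ M)
        (exp (2 * Real.pi * I * ((h + I * z) / k)) ^ M) ^ e =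
      exp (-Real.pi * I * (e * dedekindSum (M * h / M.gcd k) (k / M.gcd k) : ℝ)) *
        (((M : ℝ) / (M.gcd k : ℝ)) ^ (-(e : ℝ) / 2) : ℝ) *
        exp (log z * (-(e : ℂ) / 2)) *
        exp (Real.pi / (12 * k) * (-(e * (M.gcd k : ℂ) ^ 2 / M) / z + M * e * z)) *
        qPochhammer q' q' ^ e := by
  set g := M.gcd k with hg
  have hg0 : 0 < g := Nat.gcd_pos_of_pos_left _ hM
  obtain ⟨M', hM'⟩ : g ∣ M := Nat.gcd_dvd_left M k
  obtain ⟨k', hk'⟩ : g ∣ k := Nat.gcd_dvd_right M k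
  have hM'0 : 0 < M' := Nat.pos_of_ne_zero (by rintro rfl; simp at hM'; omega)
  have hk'0 : 0 < k' := Nat.pos_of_ne_zero (by rintro rfl; simp at hk'; omega)
  have e1 : M * h / g = M' * h := by rw [hM', mul_assoc, Nat.mul_div_cancel_left _ hg0]
  have e2 : k / g = k' := by rw [hk', Nat.mul_div_cancel_left _ hg0]
  have hcop : Nat.Coprime (M' * h) k' := by
    have h1 : Nat.Coprime (M / g) (k / g) := Nat.coprime_div_gcd_div_gcd hg0
    rw [e2, hM', Nat.mul_div_cancel_left _ hg0] at h1
    exact Nat.Coprime.mul_left h1 (hc.coprime_dvd_right ⟨g, by rw [hk', mul_comm]⟩)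
  have hgC : (g : ℂ) ≠ 0 := by exact_mod_cast hg0.ne'
  have hM'C : (M' : ℂ) ≠ 0 := by exact_mod_cast hM'0.ne'
  have hk'C : (k' : ℂ) ≠ 0 := by exact_mod_cast hk'0.ne'
  have hM'R : (0 : ℝ) < M' := by exact_mod_cast hM'0
  have hgR : (0 : ℝ) < g := by exact_mod_cast hg0
  have hk'R : (0 : ℝ) < k' := by exact_mod_cast hk'0
  have hz0 := ne_zero_of_re_pos hz
  have hzM : 0 < (((M' : ℝ) : ℂ) * z).re := by rw [re_ofReal_mul]; positivity
  -- In lowest terms `M(h + iz)/k = (M'h + i M'z)/k'`: the cusp is `M'h/k'` and the variable is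
  -- `M'z`.
  obtain ⟨q', hq', hP⟩ := qPochhammer_transform hk'0 hcop hzM
  refine ⟨q', ?_, ?_⟩
  · rw [hq', mul_inv, ← ofReal_inv, re_ofReal_mul, hM', hk']
    congr 1
    push_cast; field_simp
  · have e3 : exp (2 * Real.pi * I * ((h + I * z) / k)) ^ M =
        exp (2 * Real.pi * I * (((M' * h : ℕ) + I * (((M' : ℝ) : ℂ) * z)) / k')) := by
      rw [← exp_nat_mul]
      congr 1
      rw [hM', hk']; push_cast; field_simp
    rw [e3, hP, e1, e2, mul_zpow, mul_zpow, mul_zpow, ← exp_int_mul, ← exp_int_mul,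
      ofReal_mul_cpow hM'R hz, mul_zpow]
    have e4 : ((((M' : ℝ) : ℂ)) ^ (-(1 / 2) : ℂ)) ^ e =
        (((M : ℝ) / (g : ℝ)) ^ (-(e : ℝ) / 2) : ℝ) := by
      rw [← cpow_mul_int, show (M : ℝ) / g = M' by rw [hM']; push_cast; field_simp,
        ofReal_cpow hM'R.le]
      congr 1; push_cast; ring
    have e5 : (z ^ (-(1 / 2) : ℂ)) ^ e = exp (log z * (-(e : ℂ) / 2)) := by
      rw [← cpow_mul_int, cpow_def_of_ne_zero hz0]
      congr 1; ring
    have e6 : exp (e * (-Real.pi * I * dedekindSum (M' * h) k')) =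
        exp (-Real.pi * I * (e * dedekindSum (M' * h) k' : ℝ)) := by
      congr 1; push_cast; ring
    have e7 : exp (e * (Real.pi / (12 * k') * (((M' : ℝ) : ℂ) * z - (((M' : ℝ) : ℂ) * z)⁻¹))) =
        exp (Real.pi / (12 * k) * (-(e * (g : ℂ) ^ 2 / M) / z + M * e * z)) := by
      congr 1
      rw [hM', hk']; push_cast; field_simp; ring
    rw [e4, e5, e6, e7]; ring

/-- The behaviour of the eta quotient near the cusp `h / k`. -/
theorem G_transform {R : ℕ} (m : Fin R → ℕ) (δ : Fin R → ℤ) (hm : ∀ r, 0 < m r) {h k : ℕ}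
    (hk : 0 < k) (hc : Nat.Coprime h k) {z : ℂ} (hz : 0 < z.re) :
    ∃ q' : Fin R → ℂ, (∀ r, ‖q' r‖ =
        Real.exp (-2 * Real.pi * (((m r).gcd k : ℝ) ^ 2 / m r) * ((z⁻¹).re / k))) ∧
      G m δ (exp (2 * Real.pi * I * ((h + I * z) / k))) =
      omega m δ h k * (Delta4 m δ k : ℂ) * z ^ (Delta1 δ : ℂ) *
        exp (Real.pi / (12 * k) * (Delta3 m δ k / z + Delta2 m δ * z)) *
        ∏ r, qPochhammer (q' r) (q' r) ^ δ r := by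
  choose q' hq' hP using fun r => qPochhammer_pow_transform (hm r) (δ r) hk hc hz
  refine ⟨q', hq', ?_⟩
  rw [G, prod_congr rfl fun r _ => hP r]
  simp only [prod_mul_distrib, ← exp_sum, ← mul_sum]
  have hz0 := ne_zero_of_re_pos hz
  congr 1
  congr 1
  · congr 1
    · congr 1
      · rw [omega]; push_cast; rfl
      · rw [Delta4, ofReal_prod]
    · rw [cpow_def_of_ne_zero hz0, Delta1]
      congr 2
      push_cast
      rw [mul_sum]
      exact sum_congr rfl fun r _ => by ring
  · congr 2
    rw [sum_add_distrib, Delta3, Delta2]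
    push_cast
    rw [← sum_neg_distrib, sum_div, sum_mul]

end EtaQuotient

/-! ### The Laplace transform of a power and its inversion on a vertical line. -/

namespace EtaQuotient

open Complex MeasureTheory Filter Topology FourierTransform

lemma integrableOn_rpow_mul_exp {s b : ℝ} (hs : -1 < s) (hb : 0 < b) :
    IntegrableOn (fun t : ℝ => t ^ s * Real.exp (-b * t)) (Set.Ioi 0) := by
  simpa using integrableOn_rpow_mul_exp_neg_mul_rpow hs one_pos hb

lemma norm_rpow_mul_exp {b t : ℝ} (ht : 0 < t) (z : ℂ) :
    ‖((t ^ b : ℝ) : ℂ) * exp (-(z * t))‖ = t ^ b * Real.exp (-z.re * t) := by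
  rw [norm_mul, norm_exp, norm_real, Real.norm_of_nonneg (Real.rpow_nonneg ht.le _), neg_re,
    mul_comm z, re_ofReal_mul, neg_mul, mul_comm t]

lemma continuousOn_rpow_mul_exp (b : ℝ) (z : ℂ) :
    ContinuousOn (fun t : ℝ => ((t ^ b : ℝ) : ℂ) * exp (-(z * t))) (Set.Ioi 0) := by
  refine ContinuousOn.mul ?_ (by fun_prop)
  refine continuous_ofReal.comp_continuousOn fun t ht => ?_
  exact (Real.continuousAt_rpow_const _ _ (Or.inl (ne_of_gt ht))).continuousWithinAt

lemma integrableOn_laplace {b : ℝ} (hb : -1 < b) {z : ℂ} (hz : 0 < z.re) :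
    IntegrableOn (fun t : ℝ => ((t ^ b : ℝ) : ℂ) * exp (-(z * t))) (Set.Ioi 0) := by
  refine (integrableOn_rpow_mul_exp hb hz).mono'
    ((continuousOn_rpow_mul_exp b z).aestronglyMeasurable measurableSet_Ioi) ?_
  filter_upwards [ae_restrict_mem measurableSet_Ioi] with t ht
  rw [norm_rpow_mul_exp ht]

lemma differentiableOn_laplace {b : ℝ} (hb : -1 < b) :
    DifferentiableOn ℂ (fun z : ℂ => ∫ t in Set.Ioi (0 : ℝ), ((t ^ b : ℝ) : ℂ) * exp (-(z * t)))
      {z | 0 < z.re} := by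
  intro z hz
  have hz' : 0 < z.re := hz
  have h := hasDerivAt_integral_of_dominated_loc_of_deriv_le
    (μ := volume.restrict (Set.Ioi (0 : ℝ)))
    (F := fun (w : ℂ) (t : ℝ) => ((t ^ b : ℝ) : ℂ) * exp (-(w * t)))
    (F' := fun (w : ℂ) (t : ℝ) => -(((t ^ (b + 1) : ℝ) : ℂ) * exp (-(w * t))))
    (bound := fun t : ℝ => t ^ (b + 1) * Real.exp (-(z.re / 2) * t)) (x₀ := z)
    (s := Metric.ball z (z.re / 2)) (Metric.ball_mem_nhds _ (by positivity))
    (Eventually.of_forall fun w =>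
      (continuousOn_rpow_mul_exp b w).aestronglyMeasurable measurableSet_Ioi)
    (integrableOn_laplace hb hz')
    ((continuousOn_rpow_mul_exp (b + 1) z).neg.aestronglyMeasurable measurableSet_Ioi) ?_
    (integrableOn_rpow_mul_exp (by linarith) (by positivity)) ?_
  · exact h.2.differentiableAt.differentiableWithinAt
  · filter_upwards [ae_restrict_mem measurableSet_Ioi] with t ht w hw
    have ht : 0 < t := ht
    rw [norm_neg, norm_rpow_mul_exp ht]
    gcongr
    have h1 := (abs_re_le_norm (w - z)).trans_lt (mem_ball_iff_norm.1 hw)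
    rw [sub_re] at h1
    have := (abs_lt.1 h1).1
    linarith
  · filter_upwards [ae_restrict_mem measurableSet_Ioi] with t ht w _
    have ht : 0 < t := ht
    have h1 : HasDerivAt (fun w : ℂ => exp (-(w * t))) (exp (-(w * t)) * (-(1 * t))) w :=
      ((hasDerivAt_id w).mul_const (t : ℂ)).neg.cexp
    have h2 := h1.const_mul ((t ^ b : ℝ) : ℂ)
    refine h2.congr_deriv ?_
    rw [Real.rpow_add_one ht.ne']; push_cast; ring

/-- The Laplace transform of a power. -/
lemma integral_laplace {b : ℝ} (hb : 0 < b) {z : ℂ} (hz : 0 < z.re) :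
    ∫ t in Set.Ioi (0 : ℝ), ((t ^ (b - 1) : ℝ) : ℂ) * exp (-(z * t)) =
      Real.Gamma b * z ^ (-b : ℂ) := by
  have hopen : IsOpen {z : ℂ | 0 < z.re} := isOpen_lt continuous_const continuous_re
  have hA := (differentiableOn_laplace (b := b - 1) (by linarith)).analyticOnNhd hopen
  have hB : AnalyticOnNhd ℂ (fun z : ℂ => (Real.Gamma b : ℂ) * z ^ (-b : ℂ)) {z | 0 < z.re} := by
    refine DifferentiableOn.analyticOnNhd (fun w hw => ?_) hopen
    have : w ∈ slitPlane := Or.inl hw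
    exact ((differentiableAt_id.cpow_const this).const_mul _).differentiableWithinAt
  -- Both sides are holomorphic in the half-plane, so by the identity theorem real `z` near `1`
  -- suffice.
  refine AnalyticOnNhd.eqOn_of_preconnected_of_frequently_eq hA hB
    (convex_halfSpace_re_gt 0).isPreconnected (z₀ := ((1 : ℝ) : ℂ)) (by simp) ?_ hz
  have hev : ∀ᶠ x : ℝ in 𝓝[≠] 1, (∫ t in Set.Ioi (0 : ℝ), ((t ^ (b - 1) : ℝ) : ℂ) *
      exp (-((x : ℂ) * t))) = Real.Gamma b * (x : ℂ) ^ (-b : ℂ) := by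
    have : ∀ᶠ x : ℝ in 𝓝[≠] 1, 0 < x := (eventually_gt_nhds one_pos).filter_mono nhdsWithin_le_nhds
    filter_upwards [this] with x hx
    have h1 := Real.integral_rpow_mul_exp_neg_mul_Ioi hb hx
    have h2 : ∀ t : ℝ, ((t ^ (b - 1) : ℝ) : ℂ) * exp (-((x : ℂ) * t)) =
        ((t ^ (b - 1) * Real.exp (-(x * t)) : ℝ) : ℂ) := fun t => by push_cast; rfl
    simp_rw [h2]
    rw [integral_complex_ofReal, h1, show (-b : ℂ) = ((-b : ℝ) : ℂ) by push_cast; rfl, ← ofReal_cpow hx.le, one_div,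
      Real.inv_rpow hx.le, Real.rpow_neg hx.le]
    push_cast; ring
  have ht : Tendsto (fun x : ℝ => (x : ℂ)) (𝓝[≠] 1) (𝓝[≠] ((1 : ℝ) : ℂ)) := by
    refine tendsto_nhdsWithin_of_tendsto_nhds_of_eventually_within _
      (continuous_ofReal.continuousAt.tendsto.mono_left nhdsWithin_le_nhds) ?_
    filter_upwards [self_mem_nhdsWithin] with x hx
    simpa using hx
  exact ht.frequently hev.frequently

lemma norm_line_ge (ϱ y : ℝ) : ϱ ≤ ‖(ϱ : ℂ) + y * I‖ := by
  have := re_le_norm ((ϱ : ℂ) + y * I)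
  simpa using this

lemma norm_line_ge_abs (ϱ y : ℝ) : |y| ≤ ‖(ϱ : ℂ) + y * I‖ := by
  have := abs_im_le_norm ((ϱ : ℂ) + y * I)
  simpa using this

lemma line_re_pos {ϱ : ℝ} (hϱ : 0 < ϱ) (y : ℝ) : 0 < ((ϱ : ℂ) + y * I).re := by simpa using hϱ

lemma line_ne_zero {ϱ : ℝ} (hϱ : 0 < ϱ) (y : ℝ) : (ϱ : ℂ) + y * I ≠ 0 :=
  ne_zero_of_re_pos (line_re_pos hϱ y)

lemma continuous_line_cpow {ϱ : ℝ} (hϱ : 0 < ϱ) (s : ℂ) :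
    Continuous fun y : ℝ => ((ϱ : ℂ) + y * I) ^ s := by
  refine Continuous.cpow (by fun_prop) continuous_const fun y => ?_
  exact Or.inl (line_re_pos hϱ y)

lemma integrable_line_rpow {ϱ b : ℝ} (hϱ : 0 < ϱ) (hb : 1 < b) :
    Integrable fun y : ℝ => ‖(ϱ : ℂ) + y * I‖ ^ (-b) := by
  set c : ℝ := min ϱ 1 / 2 with hc
  have hc0 : 0 < c := by positivity
  have h1 : Integrable fun y : ℝ => c ^ (-b) * (1 + ‖y‖) ^ (-b) :=
    (integrable_one_add_norm (E := ℝ) (by simpa using hb)).const_mul _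
  refine h1.mono' ?_ (Eventually.of_forall fun y => ?_)
  · refine Continuous.aestronglyMeasurable ?_
    exact Continuous.rpow_const (by fun_prop) fun y =>
      Or.inl (norm_ne_zero_iff.2 (line_ne_zero hϱ y))
  · rw [Real.norm_of_nonneg (by positivity), ← Real.mul_rpow hc0.le (by positivity)]
    refine Real.rpow_le_rpow_of_nonpos (by positivity) ?_ (by linarith)
    have h2 := norm_line_ge ϱ y
    have h3 := norm_line_ge_abs ϱ y
    have h4 : c ≤ ϱ / 2 := by rw [hc]; gcongr; exact min_le_left _ _
    have h5 : c ≤ 1 / 2 := by rw [hc]; gcongr; exact min_le_right _ _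
    have h6 : c * ‖y‖ ≤ 1 / 2 * |y| := by rw [Real.norm_eq_abs]; gcongr
    rw [mul_add, mul_one]; linarith

lemma integrable_line_cpow {ϱ b : ℝ} (hϱ : 0 < ϱ) (hb : 1 < b) :
    Integrable fun y : ℝ => ((ϱ : ℂ) + y * I) ^ (-b : ℂ) := by
  refine (integrable_line_rpow hϱ hb).mono' (continuous_line_cpow hϱ _).aestronglyMeasurable
    (Eventually.of_forall fun y => ?_)
  rw [← ofReal_neg, norm_cpow_real]

/-- The inverse Laplace transform of a power. -/
lemma integral_line_cpow_mul_exp {ϱ b X : ℝ} (hϱ : 0 < ϱ) (hb : 1 < b) (hX : 0 < X) :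
    ∫ y : ℝ, ((ϱ : ℂ) + y * I) ^ (-b : ℂ) * exp (X * (ϱ + y * I)) =
      ((2 * Real.pi * X ^ (b - 1) / Real.Gamma b : ℝ) : ℂ) := by
  -- Fourier inversion is applied to `t^(b-1) e^(-ϱt)` on `t > 0`. The condition `b > 1` makes it
  -- continuous at `0`, where `max t 0` extends it by `0^(b-1) = 0`, and makes its transform
  -- integrable.
  set f : ℝ → ℂ := fun t => ((max t 0 ^ (b - 1) : ℝ) : ℂ) * exp (-((ϱ : ℂ) * t)) with hf
  have hf0 : ∀ t ∉ Set.Ioi (0 : ℝ), f t = 0 := by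
    intro t ht
    simp only [Set.mem_Ioi, not_lt] at ht
    simp [hf, max_eq_right ht, Real.zero_rpow (by linarith : b - 1 ≠ 0)]
  have hf1 : ∀ t ∈ Set.Ioi (0 : ℝ), f t = ((t ^ (b - 1) : ℝ) : ℂ) * exp (-((ϱ : ℂ) * t)) := by
    intro t ht
    have ht : 0 < t := ht
    simp [hf, max_eq_left ht.le]
  have hcont : Continuous f := by
    refine (continuous_ofReal.comp (Continuous.rpow_const (by fun_prop) fun _ =>
      Or.inr (by linarith))).mul (by fun_prop)
  have hint : Integrable f := by
    rw [← integrableOn_iff_integrable_of_support_subset (s := Set.Ioi 0)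
      (fun t ht => by by_contra h; exact ht (hf0 t h))]
    exact (integrableOn_laplace (b := b - 1) (z := ϱ) (by linarith) (by simpa using hϱ)).congr_fun
      (fun t ht => (hf1 t ht).symm) measurableSet_Ioi
  have hF : 𝓕 f = fun ξ : ℝ =>
      (Real.Gamma b : ℂ) * ((ϱ : ℂ) + ((2 * Real.pi * ξ : ℝ) : ℂ) * I) ^ (-b : ℂ) := by
    funext ξ
    rw [Real.fourier_real_eq_integral_exp_smul, ← integral_laplace (by linarith)
      (line_re_pos hϱ _), ← setIntegral_eq_integral_of_forall_compl_eq_zero (s := Set.Ioi 0)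
      (fun t ht => by rw [hf0 t ht, smul_zero])]
    refine setIntegral_congr_fun measurableSet_Ioi fun t ht => ?_
    rw [hf1 t ht, smul_eq_mul, mul_left_comm, ← exp_add]
    congr 2
    push_cast; ring
  have hFint : Integrable (𝓕 f) := by
    rw [hF]
    exact ((integrable_line_cpow hϱ hb).comp_mul_left' (by positivity)).const_mul _
  have hinv := congrFun (hcont.fourierInv_fourier_eq hint hFint) X
  rw [Real.fourierInv_eq', hF] at hinv
  have hG : (Real.Gamma b : ℂ) ≠ 0 := by
    exact_mod_cast (Real.Gamma_pos_of_pos (by linarith)).ne'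
  obtain ⟨Φ, hΦ⟩ : ∃ Φ : ℝ → ℂ, Φ = fun u : ℝ => ((ϱ : ℂ) + u * I) ^ (-b : ℂ) *
      exp (X * (ϱ + u * I)) := ⟨_, rfl⟩
  rw [← hΦ]
  have h1 : ∀ y : ℝ, exp (((2 * Real.pi * inner ℝ y X : ℝ) : ℂ) * I) • ((Real.Gamma b : ℂ) *
      ((ϱ : ℂ) + ((2 * Real.pi * y : ℝ) : ℂ) * I) ^ (-b : ℂ)) =
      (Real.Gamma b * exp (-(X * ϱ))) * Φ (2 * Real.pi * y) := by
    intro y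
    have : exp (((2 * Real.pi * inner ℝ y X : ℝ) : ℂ) * I) = exp (-(X * ϱ)) *
        exp (X * (ϱ + ((2 * Real.pi * y : ℝ) : ℂ) * I)) := by
      rw [← exp_add]; congr 1
      simp only [RCLike.inner_apply, conj_trivial]
      push_cast; ring
    rw [this, smul_eq_mul, hΦ]; ring
  simp_rw [h1] at hinv
  rw [integral_const_mul, Measure.integral_comp_mul_left, hf1 X hX, abs_of_pos (by positivity),
    real_smul] at hinv
  have hpi : (Real.pi : ℂ) ≠ 0 := by exact_mod_cast Real.pi_ne_zero
  have hE : exp (-(X * ϱ) : ℂ) ≠ 0 := exp_ne_zero _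
  rw [mul_comm (ϱ : ℂ)] at hinv
  push_cast at hinv ⊢
  field_simp at hinv
  rw [eq_div_iff hG, mul_comm]
  linear_combination hinv

end EtaQuotient

/-! ### Hankel's integral for the Bessel function, complete and truncated. -/

namespace EtaQuotient

open Complex MeasureTheory Filter Topology

/-- The integrand of Hankel's integral for the modified Bessel function, on a vertical line. -/
noncomputable def lineKernel (a A X ϱ : ℝ) (y : ℝ) : ℂ :=
  ((ϱ : ℂ) + y * I) ^ (-a : ℂ) * exp (X * (ϱ + y * I) + A / (ϱ + y * I))

/-- The terms of the power series of the integral of `lineKernel`. -/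
noncomputable def besselTerm (a A X : ℝ) (j : ℕ) : ℝ :=
  2 * Real.pi * (A ^ j * X ^ (a + j - 1) / (j.factorial * Real.Gamma (a + j)))

lemma continuous_lineKernel (a A X : ℝ) {ϱ : ℝ} (hϱ : 0 < ϱ) :
    Continuous (lineKernel a A X ϱ) := by
  refine (continuous_line_cpow hϱ _).mul (Continuous.cexp ?_)
  exact Continuous.add (by fun_prop)
    (continuous_const.div (by fun_prop) fun y => line_ne_zero hϱ y)

lemma norm_lineKernel (a A X ϱ y : ℝ) : ‖lineKernel a A X ϱ y‖ =
    ‖(ϱ : ℂ) + y * I‖ ^ (-a) * Real.exp (X * ϱ + A * (ϱ / (ϱ ^ 2 + y ^ 2))) := by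
  rw [lineKernel, norm_mul, ← ofReal_neg, norm_cpow_real, norm_exp]
  congr 2
  have h1 : ((A : ℂ) / (ϱ + y * I)).re = A * (ϱ / (ϱ ^ 2 + y ^ 2)) := by
    rw [div_eq_mul_inv, re_ofReal_mul, inv_re]
    congr 2
    · simp
    · simp [normSq_apply]; ring
  rw [add_re, h1, re_ofReal_mul]; simp

/-- Expand `exp(A/w)` and integrate termwise by the inverse Laplace transform. The terms are
dominated through `|w| ≥ ϱ` by multiples of `|w|^(-a)`, which is integrable as `a > 1`. -/
lemma hasSum_lineKernel {a A X ϱ : ℝ} (ha : 1 < a) (hA : 0 ≤ A) (hX : 0 < X) (hϱ : 0 < ϱ) :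
    HasSum (fun j => (besselTerm a A X j : ℂ)) (∫ y, lineKernel a A X ϱ y) := by
  set F : ℕ → ℝ → ℂ := fun j y => ((A ^ j / j.factorial : ℝ) : ℂ) *
    (((ϱ : ℂ) + y * I) ^ (-((a + j : ℝ) : ℂ)) * exp (X * (ϱ + y * I))) with hF
  have hexp : ∀ y : ℝ, ‖exp ((X : ℂ) * (ϱ + y * I))‖ = Real.exp (X * ϱ) := fun y => by
    rw [norm_exp, re_ofReal_mul]; simp
  have hnorm : ∀ j y, ‖F j y‖ ≤ A ^ j / j.factorial * ϱ⁻¹ ^ j * (Real.exp (X * ϱ) *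
      ‖(ϱ : ℂ) + y * I‖ ^ (-a)) := by
    intro j y
    have hpos : 0 < ‖(ϱ : ℂ) + y * I‖ := norm_pos_iff.2 (line_ne_zero hϱ y)
    have h1 : (‖(ϱ : ℂ) + y * I‖ ^ j)⁻¹ ≤ ϱ⁻¹ ^ j := by
      rw [inv_pow]
      have : ϱ ≤ ‖(ϱ : ℂ) + y * I‖ := norm_line_ge ϱ y
      gcongr
    simp only [hF]
    rw [norm_mul, norm_mul, hexp, ← ofReal_neg, norm_cpow_real, norm_real,
      Real.norm_of_nonneg (by positivity), neg_add, Real.rpow_add hpos, Real.rpow_neg hpos.le j,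
      Real.rpow_natCast]
    calc _ = A ^ j / j.factorial * (‖(ϱ : ℂ) + y * I‖ ^ j)⁻¹ * (Real.exp (X * ϱ) *
          ‖(ϱ : ℂ) + y * I‖ ^ (-a)) := by ring
      _ ≤ _ := by gcongr
  have hcont : ∀ j, Continuous (F j) := fun j =>
    continuous_const.mul ((continuous_line_cpow hϱ _).mul (by fun_prop))
  have hdom : Integrable fun y : ℝ => Real.exp (X * ϱ) * ‖(ϱ : ℂ) + y * I‖ ^ (-a) :=
    (integrable_line_rpow hϱ ha).const_mul _
  have hint : ∀ j, Integrable (F j) := fun j =>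
    (hdom.const_mul _).mono' (hcont j).aestronglyMeasurable (Eventually.of_forall (hnorm j))
  have hsum : Summable fun j => ∫ y, ‖F j y‖ := by
    refine Summable.of_nonneg_of_le (fun j => integral_nonneg fun y => norm_nonneg _)
      (fun j => (integral_mono (hint j).norm (hdom.const_mul _) (hnorm j)).trans
        (integral_const_mul _ _).le) ?_
    have := (Real.summable_pow_div_factorial (A * ϱ⁻¹)).mul_right
      (∫ y : ℝ, Real.exp (X * ϱ) * ‖(ϱ : ℂ) + y * I‖ ^ (-a))
    refine this.congr fun j => ?_
    rw [mul_pow]; ring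
  have h := hasSum_integral_of_summable_integral_norm hint hsum
  have h1 : ∀ j, ∫ y, F j y = besselTerm a A X j := by
    intro j
    simp only [hF]
    rw [integral_const_mul, integral_line_cpow_mul_exp hϱ
      (by linarith [(Nat.cast_nonneg j : (0 : ℝ) ≤ j)]) hX, besselTerm, ← ofReal_mul]
    congr 1
    have : (Real.Gamma (a + j)) ≠ 0 := (Real.Gamma_pos_of_pos (by positivity)).ne'
    field_simp
  have h2 : ∀ y, ∑' j, F j y = lineKernel a A X ϱ y := by
    intro y
    have hw := line_ne_zero hϱ y
    refine HasSum.tsum_eq ?_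
    have h3 := (NormedSpace.expSeries_div_hasSum_exp ((A : ℂ) / (ϱ + y * I))).mul_left
      (((ϱ : ℂ) + y * I) ^ (-a : ℂ) * exp (X * (ϱ + y * I)))
    rw [← exp_eq_exp_ℂ, mul_assoc, ← exp_add] at h3
    refine h3.congr_fun ?_
    intro j
    simp only [hF]
    rw [ofReal_add, neg_add, cpow_add _ _ hw, cpow_neg _ (((j : ℝ) : ℂ)), ofReal_natCast,
      cpow_natCast]
    push_cast
    rw [div_pow]; ring
  simp_rw [h1, h2] at h
  exact h

/-- The three-term recurrence `I_{ν-1} - I_{ν+1} = (2ν/x) I_ν` with `ν = a`, verified on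
coefficients. It matches the integration by parts in `truncatedBound_step`. -/
lemma hasSum_besselTerm_recurrence {a A X S T : ℝ} (ha : 0 ≤ a) (hX : 0 < X)
    (hS : HasSum (besselTerm (a + 1) A X) S) (hT : HasSum (besselTerm (a + 2) A X) T) :
    HasSum (besselTerm a A X) ((a * S + A * T) / X) := by
  set u : ℕ → ℝ := fun j => Nat.casesOn j 0 (fun i => A * besselTerm (a + 2) A X i) with hu
  have hu' : HasSum u (A * T) := by
    rw [← hasSum_nat_add_iff' 1]
    simpa [hu] using hT.mul_left A
  have h := ((hS.mul_left a).add hu').div_const X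
  refine h.congr_fun fun j => ?_
  have hstep : ∀ y : ℝ, X ^ y = X ^ (y - 1) * X := fun y => by
    rw [← Real.rpow_add_one hX.ne', sub_add_cancel]
  cases j with
  | zero =>
    rw [show u 0 = 0 from rfl]
    simp only [besselTerm, pow_zero, Nat.cast_zero, add_zero, Nat.factorial_zero, Nat.cast_one]
    -- For `a = 0` the initial term has `Real.Gamma 0 = 0` in its denominator and so is `0`, in
    -- accordance with `1/Γ(0) = 0`.
    rcases ha.eq_or_lt with rfl | ha'
    · simp
    · rw [Real.Gamma_add_one ha'.ne', add_sub_cancel_right, hstep a]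
      have := (Real.Gamma_pos_of_pos ha').ne'
      field_simp
  | succ i =>
    have hpos : 0 < a + (i + 1 : ℕ) := by positivity
    have hG := (Real.Gamma_pos_of_pos hpos).ne'
    simp only [hu, besselTerm]
    rw [show a + 1 + ((i + 1 : ℕ) : ℝ) = a + (i + 1 : ℕ) + 1 by ring,
      show a + 2 + (i : ℝ) = a + (i + 1 : ℕ) + 1 by push_cast; ring,
      Real.Gamma_add_one hpos.ne', add_sub_cancel_right, hstep (a + (i + 1 : ℕ)),
      Nat.factorial_succ]
    push_cast at hpos hG ⊢
    field_simp
    ring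

lemma summable_besselTerm {a A X : ℝ} (ha : 0 ≤ a) (hA : 0 ≤ A) (hX : 0 < X) :
    Summable (besselTerm a A X) := by
  have h1 : ∀ b : ℝ, 1 < b → Summable (besselTerm b A X) := fun b hb => by
    have := (hasSum_lineKernel hb hA hX one_pos).summable
    exact_mod_cast this
  have h2 : ∀ b : ℝ, 0 < b → Summable (besselTerm b A X) := fun b hb =>
    (hasSum_besselTerm_recurrence hb.le hX (h1 _ (by linarith)).hasSum
      (h1 _ (by linarith)).hasSum).summable
  exact (hasSum_besselTerm_recurrence ha hX (h2 _ (by linarith)).hasSum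
    (h2 _ (by linarith)).hasSum).summable

/-- For `|y| ≥ θ` the real part of `Xw + A/w` is at most `Xϱ + Aϱ/θ² ≤ 2K`, so only the power
decays. -/
lemma norm_lineKernel_le {a A X ϱ θ y K : ℝ} (ha : 0 ≤ a) (hA : 0 ≤ A) (hϱ : 0 < ϱ) (hθ : 0 < θ)
    (h1 : X * ϱ ≤ K) (h2 : A * ϱ ≤ K * θ ^ 2) (hy : θ ≤ |y|) :
    ‖lineKernel a A X ϱ y‖ ≤ Real.exp (2 * K) * |y| ^ (-a) := by
  have hy0 : 0 < |y| := hθ.trans_le hy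
  rw [norm_lineKernel, mul_comm]
  refine mul_le_mul (Real.exp_le_exp.2 ?_) (Real.rpow_le_rpow_of_nonpos hy0
    (norm_line_ge_abs ϱ y) (by linarith)) (by positivity) (by positivity)
  have h3 : A * (ϱ / (ϱ ^ 2 + y ^ 2)) ≤ K := by
    rw [← mul_div_assoc, div_le_iff₀ (by positivity)]
    have hK : 0 ≤ K := by
      have : 0 ≤ K * θ ^ 2 := (by positivity : 0 ≤ A * ϱ).trans h2
      exact nonneg_of_mul_nonneg_left this (by positivity)
    have h4 : θ ^ 2 ≤ y ^ 2 := by rw [← sq_abs y]; gcongr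
    calc A * ϱ ≤ K * θ ^ 2 := h2
      _ ≤ K * (ϱ ^ 2 + y ^ 2) := by gcongr; nlinarith [sq_nonneg ϱ]
  linarith

lemma norm_integral_lineKernel_sub_le {a A X ϱ θ K : ℝ} (ha : 1 < a) (hA : 0 ≤ A)
    (hϱ : 0 < ϱ) (hθ : 0 < θ) (h1 : X * ϱ ≤ K) (h2 : A * ϱ ≤ K * θ ^ 2) :
    ‖(∫ y in -θ..θ, lineKernel a A X ϱ y) - ∫ y, lineKernel a A X ϱ y‖ ≤
      2 * Real.exp (2 * K) / (a - 1) * θ ^ (1 - a) := by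
  have hint : Integrable (lineKernel a A X ϱ) := by
    refine ((integrable_line_rpow hϱ ha).const_mul (Real.exp (X * ϱ + A * ϱ⁻¹))).mono'
      (continuous_lineKernel a A X hϱ).aestronglyMeasurable (Eventually.of_forall fun y => ?_)
    rw [norm_lineKernel, mul_comm]
    gcongr
    rw [div_le_iff₀ (by positivity)]
    have : ϱ⁻¹ * (ϱ ^ 2 + y ^ 2) = ϱ + ϱ⁻¹ * y ^ 2 := by field_simp
    rw [this]
    have : 0 ≤ ϱ⁻¹ * y ^ 2 := by positivity
    linarith
  have htail : IntegrableOn (fun y : ℝ => Real.exp (2 * K) * y ^ (-a)) (Set.Ioi θ) :=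
    (integrableOn_Ioi_rpow_of_lt (by linarith) hθ).const_mul _
  have hval : ∫ y in Set.Ioi θ, Real.exp (2 * K) * y ^ (-a) =
      Real.exp (2 * K) / (a - 1) * θ ^ (1 - a) := by
    rw [integral_const_mul, integral_Ioi_rpow_of_lt (by linarith) hθ,
      show -a + 1 = 1 - a by ring, show (1 - a) = -(a - 1) by ring, neg_div_neg_eq]; ring
  have hR : ‖∫ y in Set.Ioi θ, lineKernel a A X ϱ y‖ ≤
      Real.exp (2 * K) / (a - 1) * θ ^ (1 - a) := by
    rw [← hval]
    refine norm_integral_le_of_norm_le htail ?_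
    filter_upwards [ae_restrict_mem measurableSet_Ioi] with y hy
    have hy : θ < y := hy
    have := norm_lineKernel_le (a := a) (y := y) (by linarith) hA hϱ hθ h1 h2
      (by rw [abs_of_pos (hθ.trans hy)]; exact hy.le)
    rwa [abs_of_pos (hθ.trans hy)] at this
  have hL : ‖∫ y in Set.Iic (-θ), lineKernel a A X ϱ y‖ ≤
      Real.exp (2 * K) / (a - 1) * θ ^ (1 - a) := by
    rw [← integral_comp_neg_Ioi, ← hval]
    refine norm_integral_le_of_norm_le htail ?_
    filter_upwards [ae_restrict_mem measurableSet_Ioi] with y hy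
    have hy : θ < y := hy
    have := norm_lineKernel_le (a := a) (y := -y) (by linarith) hA hϱ hθ h1 h2
      (by rw [abs_neg, abs_of_pos (hθ.trans hy)]; exact hy.le)
    rwa [abs_neg, abs_of_pos (hθ.trans hy)] at this
  have e1 := intervalIntegral.integral_Iic_sub_Iic (a := -θ) (b := θ) hint.integrableOn
    hint.integrableOn
  have e2 := intervalIntegral.integral_Iic_add_Ioi (b := θ) hint.integrableOn hint.integrableOn
  have e3 : (∫ y in -θ..θ, lineKernel a A X ϱ y) - ∫ y, lineKernel a A X ϱ y =
      -(∫ y in Set.Iic (-θ), lineKernel a A X ϱ y) - ∫ y in Set.Ioi θ, lineKernel a A X ϱ y := by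
    rw [← e1, ← e2]; ring
  rw [e3]
  refine (norm_sub_le _ _).trans ?_
  rw [norm_neg]
  refine (add_le_add hL hR).trans (le_of_eq ?_)
  ring

/-- The truncated integral of `lineKernel` is the sum of `besselTerm` up to `O(θ ^ (1 - a))`,
uniformly in the other parameters as constrained by `K`. -/
def TruncatedBound (K a C : ℝ) : Prop :=
  ∀ ϱ θ X A : ℝ, 0 < ϱ → 0 < θ → 0 < X → 0 ≤ A → X * ϱ ≤ K → A * ϱ ≤ K * θ ^ 2 →
    A ≤ K * X * θ ^ 2 → 1 ≤ K * (θ * X) →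
    ‖(∫ y in -θ..θ, lineKernel a A X ϱ y) - ((∑' j, besselTerm a A X j : ℝ) : ℂ)‖ ≤
      C * θ ^ (1 - a)

lemma truncatedBound_of_one_lt (K : ℝ) {a : ℝ} (ha : 1 < a) :
    TruncatedBound K a (2 * Real.exp (2 * K) / (a - 1)) := by
  intro ϱ θ X A hϱ hθ hX hA h1 h2 _ _
  rw [ofReal_tsum, (hasSum_lineKernel ha hA hX hϱ).tsum_eq]
  exact norm_integral_lineKernel_sub_le ha hA hϱ hθ h1 h2

lemma hasDerivAt_lineKernel (a A X : ℝ) {ϱ : ℝ} (hϱ : 0 < ϱ) (y : ℝ) :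
    HasDerivAt (lineKernel a A X ϱ) (I * (X * lineKernel a A X ϱ y -
      a * lineKernel (a + 1) A X ϱ y - A * lineKernel (a + 2) A X ϱ y)) y := by
  have hw := line_ne_zero hϱ y
  have hline : HasDerivAt (fun y : ℝ => (ϱ : ℂ) + y * I) I y := by
    simpa using ((hasDerivAt_id y).ofReal_comp.mul_const I).const_add (ϱ : ℂ)
  have h1 : HasDerivAt (fun y : ℝ => ((ϱ : ℂ) + y * I) ^ (-a : ℂ))
      ((-a : ℂ) * ((ϱ : ℂ) + y * I) ^ (-a - 1 : ℂ) * 1 * I) y := by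
    have h := (hasDerivAt_id ((ϱ : ℂ) + y * I)).cpow_const (c := (-a : ℂ))
      (Or.inl (line_re_pos hϱ y))
    exact h.comp y hline
  have h2 := ((hline.const_mul (X : ℂ)).add ((hline.inv hw).const_mul (A : ℂ))).cexp
  have h3 := h1.mul h2
  have hfun : lineKernel a A X ϱ = (fun y : ℝ => ((ϱ : ℂ) + y * I) ^ (-a : ℂ)) * fun y : ℝ =>
      exp (((fun y : ℝ => (X : ℂ) * (ϱ + y * I)) + fun y : ℝ => (A : ℂ) *
        ((fun y : ℝ => (ϱ : ℂ) + y * I)⁻¹ y)) y) := by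
    funext y
    simp [lineKernel, div_eq_mul_inv]
  rw [hfun]
  refine h3.congr_deriv ?_
  have e1 : ((ϱ : ℂ) + y * I) ^ (-a - 1 : ℂ) = ((ϱ : ℂ) + y * I) ^ (-a : ℂ) / (ϱ + y * I) := by
    rw [cpow_sub _ _ hw, cpow_one]
  have e2 : ((ϱ : ℂ) + y * I) ^ (-((a + 1 : ℝ) : ℂ)) =
      ((ϱ : ℂ) + y * I) ^ (-a : ℂ) / (ϱ + y * I) := by
    rw [← e1]; congr 1; push_cast; ring
  have e3 : ((ϱ : ℂ) + y * I) ^ (-((a + 2 : ℝ) : ℂ)) =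
      ((ϱ : ℂ) + y * I) ^ (-a : ℂ) / (ϱ + y * I) ^ 2 := by
    rw [show (-((a + 2 : ℝ) : ℂ)) = -a - (2 : ℕ) by push_cast; ring, cpow_sub _ _ hw, cpow_natCast]
  simp only [lineKernel, e1, e2, e3, Pi.add_apply, Pi.inv_apply, Pi.mul_apply, div_eq_mul_inv]
  ring

/-- Integrating the derivative of the kernel over `[-θ, θ]` expresses `X` times the integral for `a`
through those for `a + 1` and `a + 2` and two boundary values of size `θ^(-a)`. The series satisfy
the same relation without boundary terms. The constraints `1 ≤ KθX` and `A ≤ KXθ²` pay for the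
division by `X`. -/
lemma truncatedBound_step {K a C : ℝ} (hC : 0 ≤ C) (ha : 0 ≤ a)
    (h1 : TruncatedBound K (a + 1) C) (h2 : TruncatedBound K (a + 2) C) :
    TruncatedBound K a (K * (2 * Real.exp (2 * K) + a * C + C)) := by
  intro ϱ θ X A hϱ hθ hX hA g1 g2 g3 g4
  have i1 := h1 ϱ θ X A hϱ hθ hX hA g1 g2 g3 g4
  have i2 := h2 ϱ θ X A hϱ hθ hX hA g1 g2 g3 g4
  have hs := (hasSum_besselTerm_recurrence ha hX (summable_besselTerm (a := a + 1) (by linarith)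
    hA hX).hasSum (summable_besselTerm (a := a + 2) (by linarith) hA hX).hasSum).tsum_eq
  rw [hs]
  set S := ∑' j, besselTerm (a + 1) A X j
  set T := ∑' j, besselTerm (a + 2) A X j
  have hci : ∀ b, IntervalIntegrable (lineKernel b A X ϱ) volume (-θ) θ := fun b =>
    (continuous_lineKernel b A X hϱ).intervalIntegrable _ _
  have hparts := intervalIntegral.integral_eq_sub_of_hasDerivAt (a := -θ) (b := θ)
    (fun y _ => hasDerivAt_lineKernel a A X hϱ y)
    ((continuous_const.mul (((continuous_const.mul (continuous_lineKernel a A X hϱ)).sub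
      (continuous_const.mul (continuous_lineKernel (a + 1) A X hϱ))).sub
      (continuous_const.mul (continuous_lineKernel (a + 2) A X hϱ)))).intervalIntegrable _ _)
  rw [intervalIntegral.integral_const_mul, intervalIntegral.integral_sub
    (((hci a).const_mul _).sub ((hci _).const_mul _)) ((hci _).const_mul _),
    intervalIntegral.integral_sub ((hci a).const_mul _) ((hci _).const_mul _),
    intervalIntegral.integral_const_mul, intervalIntegral.integral_const_mul,
    intervalIntegral.integral_const_mul] at hparts
  set J0 := ∫ y in -θ..θ, lineKernel a A X ϱ y
  set J1 := ∫ y in -θ..θ, lineKernel (a + 1) A X ϱ y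
  set J2 := ∫ y in -θ..θ, lineKernel (a + 2) A X ϱ y
  have hXC : (X : ℂ) ≠ 0 := by exact_mod_cast hX.ne'
  have e : J0 - (((a * S + A * T) / X : ℝ) : ℂ) = (-I * (lineKernel a A X ϱ θ -
      lineKernel a A X ϱ (-θ)) + a * (J1 - S) + A * (J2 - T)) / X := by
    rw [← hparts]; push_cast; field_simp
    linear_combination (X * J0 - a * J1 - A * J2) * I_sq
  rw [e, norm_div, norm_real, Real.norm_of_nonneg hX.le, div_le_iff₀ hX]
  have b1 : ‖lineKernel a A X ϱ θ‖ ≤ Real.exp (2 * K) * θ ^ (-a) := by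
    have := norm_lineKernel_le (y := θ) ha hA hϱ hθ g1 g2 (by rw [abs_of_pos hθ])
    rwa [abs_of_pos hθ] at this
  have b2 : ‖lineKernel a A X ϱ (-θ)‖ ≤ Real.exp (2 * K) * θ ^ (-a) := by
    have := norm_lineKernel_le (y := -θ) ha hA hϱ hθ g1 g2 (by rw [abs_neg, abs_of_pos hθ])
    rwa [abs_neg, abs_of_pos hθ] at this
  have p1 : θ ^ (1 - a) = θ ^ (-a) * θ := by
    rw [← Real.rpow_add_one hθ.ne']; congr 1; ring
  have p2 : θ ^ (1 - (a + 1)) = θ ^ (-a) := by congr 1; ring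
  have p3 : θ ^ (-a) = θ ^ (1 - (a + 2)) * θ := by
    rw [← Real.rpow_add_one hθ.ne']; congr 1; ring
  have hp : 0 < θ ^ (-a) := by positivity
  have hq : 0 < θ ^ (1 - (a + 2)) := by positivity
  rw [p2] at i1
  have n1 : ‖-I * (lineKernel a A X ϱ θ - lineKernel a A X ϱ (-θ)) + a * (J1 - S) +
      A * (J2 - T)‖ ≤ 2 * (Real.exp (2 * K) * θ ^ (-a)) + a * (C * θ ^ (-a)) +
        A * (C * θ ^ (1 - (a + 2))) := by
    refine (norm_add_le _ _).trans (add_le_add ((norm_add_le _ _).trans (add_le_add ?_ ?_)) ?_)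
    · rw [norm_mul, norm_neg, norm_I, one_mul]
      exact (norm_sub_le _ _).trans (by linarith)
    · rw [norm_mul, norm_real, Real.norm_of_nonneg ha]; gcongr
    · rw [norm_mul, norm_real, Real.norm_of_nonneg hA]; gcongr
  refine n1.trans ?_
  have m1 : θ ^ (-a) ≤ K * (θ ^ (1 - a) * X) := by
    rw [p1]
    calc θ ^ (-a) = θ ^ (-a) * 1 := (mul_one _).symm
      _ ≤ θ ^ (-a) * (K * (θ * X)) := by gcongr
      _ = _ := by ring
  have m2 : A * θ ^ (1 - (a + 2)) ≤ K * (θ ^ (1 - a) * X) := by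
    rw [p1, p3]
    calc A * θ ^ (1 - (a + 2)) ≤ (K * X * θ ^ 2) * θ ^ (1 - (a + 2)) := by gcongr
      _ = _ := by ring
  calc _ = 2 * Real.exp (2 * K) * θ ^ (-a) + a * C * θ ^ (-a) +
        C * (A * θ ^ (1 - (a + 2))) := by ring
    _ ≤ 2 * Real.exp (2 * K) * (K * (θ ^ (1 - a) * X)) + a * C * (K * (θ ^ (1 - a) * X)) +
        C * (K * (θ ^ (1 - a) * X)) := by gcongr
    _ = _ := by ring

lemma TruncatedBound.mono {K a C C' : ℝ} (h : TruncatedBound K a C) (hC : C ≤ C') :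
    TruncatedBound K a C' := by
  intro ϱ θ X A hϱ hθ hX hA g1 g2 g3 g4
  refine (h ϱ θ X A hϱ hθ hX hA g1 g2 g3 g4).trans ?_
  gcongr

/-- Two descents reach every `a ≥ 0`: from `a > 1`, where the tails converge, to `a > 0`, and then
to `a = 0`. Here `a` will be `-Δ₁`. -/
lemma exists_truncatedBound {K a : ℝ} (hK : 0 ≤ K) (ha : 0 ≤ a) :
    ∃ C, 0 ≤ C ∧ TruncatedBound K a C := by
  have base : ∀ b : ℝ, 1 < b → ∃ C, 0 ≤ C ∧ TruncatedBound K b C := fun b hb =>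
    ⟨_, div_nonneg (by positivity) (by linarith), truncatedBound_of_one_lt K hb⟩
  have step : ∀ b : ℝ, 0 ≤ b → (∃ C, 0 ≤ C ∧ TruncatedBound K (b + 1) C) →
      (∃ C, 0 ≤ C ∧ TruncatedBound K (b + 2) C) → ∃ C, 0 ≤ C ∧ TruncatedBound K b C := by
    rintro b hb ⟨C, hC, h⟩ ⟨C', hC', h'⟩
    exact ⟨_, by positivity, truncatedBound_step (C := C + C') (by positivity) hb
      (h.mono (by linarith)) (h'.mono (by linarith))⟩
  have pos : ∀ b : ℝ, 0 < b → ∃ C, 0 ≤ C ∧ TruncatedBound K b C := fun b hb =>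
    step b hb.le (base _ (by linarith)) (base _ (by linarith))
  exact step a ha (pos _ (by linarith)) (pos _ (by linarith))

/-- The power series of the truncated integral in terms of the Bessel function. -/
lemma tsum_besselTerm {a A X : ℝ} (hA : 0 < A) (hX : 0 < X) :
    ∑' j, besselTerm a A X j =
      2 * Real.pi * (X / A) ^ ((a - 1) / 2) * besselI (a - 1) (2 * Real.sqrt (A * X)) := by
  rw [besselI, ← tsum_mul_left]
  congr 1
  funext j
  have h1 : 2 * Real.sqrt (A * X) / 2 = (A * X) ^ (1 / 2 : ℝ) := by
    rw [← Real.sqrt_eq_rpow]; ring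
  rw [h1, besselTerm, ← Real.rpow_mul (by positivity), Real.div_rpow hX.le hA.le,
    Real.mul_rpow hA.le hX.le, show (j : ℝ) + (a - 1) + 1 = a + j by ring]
  have h2 : (1 / 2 : ℝ) * (2 * j + (a - 1)) = j + (a - 1) / 2 := by ring
  rw [h2, Real.rpow_add hA, Real.rpow_natCast,
    show a + j - 1 = (a - 1) / 2 + (j + (a - 1) / 2) by ring, Real.rpow_add hX]
  have : A ^ ((a - 1) / 2) ≠ 0 := by positivity
  field_simp

end EtaQuotient

/-! ### Cauchy's formula and the dissection of a period. -/

namespace EtaQuotient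

open Complex MeasureTheory Filter Topology

lemma integral_exp_two_pi_mul (j n : ℕ) (ϱ t₀ : ℝ) :
    ∫ t in t₀..t₀ + 1, exp (2 * Real.pi * I * ((j : ℂ) - n) * (t + I * ϱ)) =
      if j = n then 1 else 0 := by
  split_ifs with h
  · simp [h]
  · have hc : 2 * Real.pi * I * ((j : ℂ) - n) ≠ 0 :=
      mul_ne_zero two_pi_I_ne_zero (sub_ne_zero.2 (by exact_mod_cast h))
    have h1 : ∀ t : ℝ, exp (2 * Real.pi * I * ((j : ℂ) - n) * (t + I * ϱ)) =
        exp (2 * Real.pi * I * ((j : ℂ) - n) * (I * ϱ)) *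
          exp (2 * Real.pi * I * ((j : ℂ) - n) * t) := fun t => by
      rw [← exp_add]; congr 1; ring
    simp_rw [h1]
    rw [intervalIntegral.integral_const_mul, integral_exp_mul_complex hc]
    have h2 : exp (2 * Real.pi * I * ((j : ℂ) - n) * ((t₀ + 1 : ℝ) : ℂ)) =
        exp (2 * Real.pi * I * ((j : ℂ) - n) * t₀) := by
      rw [show 2 * Real.pi * I * ((j : ℂ) - n) * ((t₀ + 1 : ℝ) : ℂ) =
        2 * Real.pi * I * ((j : ℂ) - n) * t₀ + ((j - n : ℤ) : ℂ) * (2 * Real.pi * I) by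
          push_cast; ring, exp_periodic.int_mul]
    rw [h2, sub_self, zero_div, mul_zero]

/-- Cauchy's formula for the coefficients of a power series on the unit disk. -/
lemma coeff_eq_integral {c : ℕ → ℂ} {f : ℂ → ℂ}
    (hf : ∀ q : ℂ, ‖q‖ < 1 → HasSum (fun j => c j * q ^ j) (f q)) (n : ℕ) {ϱ : ℝ} (hϱ : 0 < ϱ)
    (t₀ : ℝ) : ∫ t in t₀..t₀ + 1, f (exp (2 * Real.pi * I * (t + I * ϱ))) *
      exp (-(2 * Real.pi * I * n * (t + I * ϱ))) = c n := by
  have hnorm : ∀ t : ℝ, ‖exp (2 * Real.pi * I * (t + I * ϱ))‖ = Real.exp (-(2 * Real.pi * ϱ)) := by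
    intro t
    rw [norm_exp]; congr 1; simp
  have hlt : Real.exp (-(2 * Real.pi * ϱ)) < 1 := by
    rw [Real.exp_lt_one_iff]; have := Real.pi_pos; nlinarith [mul_pos this hϱ]
  set F : ℕ → ℝ → ℂ := fun j t => c j * exp (2 * Real.pi * I * ((j : ℂ) - n) * (t + I * ϱ)) with hF
  have hFn : ∀ j t, ‖F j t‖ = ‖c j‖ * Real.exp (-(2 * Real.pi * ϱ)) ^ j *
      Real.exp (2 * Real.pi * n * ϱ) := by
    intro j t
    rw [hF, norm_mul, norm_exp, ← Real.exp_nat_mul, mul_assoc ‖c j‖, ← Real.exp_add]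
    congr 2
    simp; ring
  have hsum : Summable fun j => ‖c j‖ * Real.exp (-(2 * Real.pi * ϱ)) ^ j *
      Real.exp (2 * Real.pi * n * ϱ) := by
    refine Summable.mul_right _ ?_
    have h0 := (hf (Real.exp (-(2 * Real.pi * ϱ)) : ℝ) (by
      rw [norm_real, Real.norm_of_nonneg (Real.exp_pos _).le]; exact hlt)).summable.norm
    refine h0.congr fun j => ?_
    rw [norm_mul, norm_pow, norm_real, Real.norm_of_nonneg (Real.exp_pos _).le]
  have hint : ∀ j, Integrable (F j) (volume.restrict (Set.Ioc t₀ (t₀ + 1))) := fun j =>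
    ((by fun_prop : Continuous (F j)).integrableOn_Ioc)
  have h := hasSum_integral_of_summable_integral_norm hint (by
    simp_rw [hFn]
    simpa using hsum)
  have h1 : ∀ j, ∫ t in Set.Ioc t₀ (t₀ + 1), F j t = if j = n then c n else 0 := by
    intro j
    rw [← intervalIntegral.integral_of_le (by linarith), hF,
      intervalIntegral.integral_const_mul, integral_exp_two_pi_mul]
    split_ifs with hj <;> simp [hj]
  have h2 : ∀ t, ∑' j, F j t = f (exp (2 * Real.pi * I * (t + I * ϱ))) *
      exp (-(2 * Real.pi * I * n * (t + I * ϱ))) := by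
    intro t
    refine HasSum.tsum_eq (((hf _ (by rw [hnorm]; exact hlt)).mul_right _).congr_fun fun j => ?_)
    simp only [hF]
    rw [mul_assoc (c j), ← exp_nat_mul, ← exp_add]
    congr 2; ring
  simp_rw [h1, h2] at h
  rw [intervalIntegral.integral_of_le (by linarith)]
  exact h.unique (hasSum_ite_eq n (c n))

lemma inv_mul_le_abs_sub {h k h' k' : ℕ} (hk : 0 < k) (hk' : 0 < k') (hne : h * k' ≠ h' * k) :
    1 / ((k : ℝ) * k') ≤ |(h : ℝ) / k - h' / k'| := by
  have hkR : (0 : ℝ) < k := by exact_mod_cast hk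
  have hkR' : (0 : ℝ) < k' := by exact_mod_cast hk'
  have h1 : (h : ℝ) / k - h' / k' = ((h * k' - h' * k : ℤ) : ℝ) / (k * k') := by
    push_cast; field_simp
  have h2 : (1 : ℤ) ≤ |(h * k' - h' * k : ℤ)| :=
    Int.one_le_abs (sub_ne_zero.2 (by exact_mod_cast hne))
  rw [h1, abs_div, abs_of_pos (mul_pos hkR hkR')]
  gcongr
  exact_mod_cast h2

lemma eq_of_coprime_of_mul_eq {h k h' k' : ℕ} (hk : 0 < k) (hc : Nat.Coprime h k)
    (hc' : Nat.Coprime h' k') (he : h * k' = h' * k) : h = h' ∧ k = k' := by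
  have h1 : k ∣ k' := Nat.Coprime.dvd_of_dvd_mul_left (Nat.coprime_comm.1 hc)
    (he ▸ dvd_mul_left _ _)
  have h2 : k' ∣ k := Nat.Coprime.dvd_of_dvd_mul_left (Nat.coprime_comm.1 hc')
    (he ▸ dvd_mul_left _ _)
  obtain rfl := Nat.dvd_antisymm h1 h2
  exact ⟨Nat.eq_of_mul_eq_mul_right hk he, rfl⟩

/-- Dissection of a period at the fractions of denominator at most `N`. Around `h / k` the interval
of radius `1 / (2 k N)` is kept; these are disjoint, and what is left is covered by the
concentric annuli of outer radius `1 / (k N)`. -/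
theorem norm_integral_sub_sum_le {F : ℝ → ℂ} (hF : Continuous F) {N : ℕ} (hN : 0 < N)
    {B : ℕ → ℝ} (hB0 : ∀ k, 0 ≤ B k)
    (hB : ∀ k h : ℕ, 1 ≤ k → k ≤ N → Nat.Coprime h k → ∀ y : ℝ, 1 / (2 * k * N) ≤ |y| →
      |y| ≤ 1 / (k * N) → ‖F (h / k + y)‖ ≤ B k) :
    ‖(∫ t in -(1 / (2 * (N : ℝ)))..-(1 / (2 * (N : ℝ))) + 1, F t) -
      ∑ k ∈ Icc 1 N, ∑ h ∈ (range k).filter (fun h => Nat.gcd h k = 1),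
        ∫ y in -(1 / (2 * (k : ℝ) * N))..1 / (2 * k * N), F (h / k + y)‖ ≤
      ∑ k ∈ Icc 1 N, ((k : ℝ) + 1) * (B k * (2 / (k * N))) := by
  have hNR : (0 : ℝ) < N := by exact_mod_cast hN
  set P : Finset (Σ _ : ℕ, ℕ) := (Icc 1 N).sigma fun k => (range k).filter
    (fun h => Nat.gcd h k = 1) with hP
  -- Unlike in `P`, `h = k` is allowed, since leftover points near `1` are approximated by `1/1`.
  -- Coprimality is dropped as well, which gives the factor `k + 1` in the bound.
  set Q : Finset (Σ _ : ℕ, ℕ) := (Icc 1 N).sigma fun k => range (k + 1) with hQ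
  set M : (Σ _ : ℕ, ℕ) → Set ℝ := fun p =>
    Set.Ioc ((p.2 : ℝ) / p.1 - 1 / (2 * p.1 * N)) ((p.2 : ℝ) / p.1 + 1 / (2 * p.1 * N)) with hM
  set A : (Σ _ : ℕ, ℕ) → Set ℝ := fun p =>
    Set.Icc ((p.2 : ℝ) / p.1 - 1 / (p.1 * N)) ((p.2 : ℝ) / p.1 + 1 / (p.1 * N)) with hA
  set J : Set ℝ := Set.Ioc (-(1 / (2 * (N : ℝ)))) (-(1 / (2 * (N : ℝ))) + 1) with hJ
  have hPmem : ∀ p ∈ P, 0 < p.1 ∧ p.1 ≤ N ∧ p.2 < p.1 ∧ Nat.Coprime p.2 p.1 := by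
    rintro ⟨k, h⟩ hp
    simp only [hP, mem_sigma, mem_Icc, mem_filter, mem_range] at hp
    exact ⟨hp.1.1, hp.1.2, hp.2.1, hp.2.2⟩
  -- Distinct fractions are at least `1/(kk')` apart, while the radii add up to `(k + k')/(2Nkk') ≤
  -- 1/(kk')`.
  have hdisj : Set.Pairwise (P : Set (Σ _ : ℕ, ℕ)) (Function.onFun Disjoint M) := by
    rintro ⟨k, h⟩ hp ⟨k', h'⟩ hp' hne
    obtain ⟨hk, hkN, -, hc⟩ := hPmem _ hp
    obtain ⟨hk', hkN', -, hc'⟩ := hPmem _ hp'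
    simp only at hk hkN hc hk' hkN' hc'
    have hmul : h * k' ≠ h' * k := fun he => by
      obtain ⟨rfl, rfl⟩ := eq_of_coprime_of_mul_eq hk hc hc' he
      exact hne rfl
    have hsep := inv_mul_le_abs_sub hk hk' hmul
    have hkR : (0 : ℝ) < k := by exact_mod_cast hk
    have hkR' : (0 : ℝ) < k' := by exact_mod_cast hk'
    have hle : 1 / (2 * (k : ℝ) * N) + 1 / (2 * k' * N) ≤ 1 / ((k : ℝ) * k') := by
      have e : 1 / (2 * (k : ℝ) * N) + 1 / (2 * k' * N) = (k + k') / (2 * N) / (k * k') := by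
        field_simp; ring
      rw [e]
      gcongr
      rw [div_le_one (by positivity)]
      have : (k : ℝ) ≤ N := by exact_mod_cast hkN
      have : (k' : ℝ) ≤ N := by exact_mod_cast hkN'
      linarith
    refine Set.disjoint_left.2 fun t ht ht' => ?_
    simp only [hM, Set.mem_Ioc] at ht ht'
    have : |(h : ℝ) / k - h' / k'| < 1 / (2 * (k : ℝ) * N) + 1 / (2 * k' * N) := by
      rw [abs_lt]; constructor <;> linarith
    linarith
  -- Starting the period at `-1/(2N)` makes the whole interval about `0/1` fit.
  have hMJ : ∀ p ∈ P, M p ⊆ J := by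
    rintro ⟨k, h⟩ hp
    obtain ⟨hk, hkN, hhk, hc⟩ := hPmem _ hp
    simp only at hk hkN hhk hc
    have hkR : (0 : ℝ) < k := by exact_mod_cast hk
    have hkNR : (k : ℝ) ≤ N := by exact_mod_cast hkN
    have hN1 : (1 : ℝ) ≤ N := by exact_mod_cast hN
    refine Set.Ioc_subset_Ioc ?_ ?_
    · rcases Nat.eq_zero_or_pos h with rfl | hh
      · obtain rfl : k = 1 := by simpa using hc
        simp
      · have h1 : 1 / (2 * (k : ℝ) * N) ≤ 1 / k := by
          gcongr; nlinarith
        have h2 : 1 / (k : ℝ) ≤ h / k := by gcongr; exact_mod_cast hh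
        have h3 : 0 < 1 / (2 * (N : ℝ)) := by positivity
        simp only
        linarith
    · have h1 : 1 / (2 * (k : ℝ) * N) ≤ 1 / (2 * k) :=
        one_div_le_one_div_of_le (by positivity) (by nlinarith)
      have h2 : 1 / (2 * (N : ℝ)) ≤ 1 / (2 * k) := by gcongr
      have h3 : (h : ℝ) / k ≤ 1 - 1 / k := by
        rw [div_le_iff₀ hkR, sub_mul, div_mul_cancel₀ _ hkR.ne']
        have : (h : ℝ) + 1 ≤ k := by exact_mod_cast hhk
        linarith
      have h4 : 1 / (2 * (k : ℝ)) + 1 / (2 * k) = 1 / k := by field_simp; norm_num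
      simp only
      linarith
  have hMmeas : ∀ p, MeasurableSet (M p) := fun p => measurableSet_Ioc
  have hUmeas : MeasurableSet (⋃ p ∈ P, M p) := Finset.measurableSet_biUnion _ fun p _ => hMmeas p
  have hUJ : (⋃ p ∈ P, M p) ⊆ J := Set.iUnion₂_subset hMJ
  have hJint : IntegrableOn F J := hF.integrableOn_Ioc
  have e1 : ∫ t in ⋃ p ∈ P, M p, F t = ∑ p ∈ P, ∫ t in M p, F t :=
    integral_biUnion_finset P (fun p _ => hMmeas p) hdisj fun p _ => hF.integrableOn_Ioc
  have e2 : ∑ k ∈ Icc 1 N, ∑ h ∈ (range k).filter (fun h => Nat.gcd h k = 1),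
        ∫ y in -(1 / (2 * (k : ℝ) * N))..1 / (2 * k * N), F (h / k + y) =
      ∑ p ∈ P, ∫ t in M p, F t := by
    rw [hP, sum_sigma]
    refine sum_congr rfl fun k _ => sum_congr rfl fun h _ => ?_
    rw [intervalIntegral.integral_comp_add_left (fun t => F t),
      intervalIntegral.integral_of_le, ← sub_eq_add_neg]
    have : 0 ≤ 1 / (2 * (k : ℝ) * N) := by positivity
    linarith
  rw [intervalIntegral.integral_of_le (by linarith), e2, ← e1, ← setIntegral_sdiff hUmeas hJint hUJ]
  set S : Set ℝ := J \ ⋃ p ∈ P, M p with hS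
  have hcover : ∀ t ∈ S, ∃ p ∈ Q, t ∈ A p ∧ ‖F t‖ ≤ B p.1 := by
    rintro t ⟨htJ, htU⟩
    -- Dirichlet's theorem gives `|t - q| ≤ 1/((N + 1) den) ≤ 1/(den N)`, the outer radius. The
    -- inner radius is exceeded because `t` avoids the kept intervals.
    obtain ⟨q, hq, hqN⟩ := Real.exists_rat_abs_sub_le_and_den_le t hN
    have hk : 0 < q.den := q.den_pos
    have hkR : (0 : ℝ) < q.den := by exact_mod_cast hk
    have hkNR : (q.den : ℝ) ≤ N := by exact_mod_cast hqN
    have hN1 : (1 : ℝ) ≤ N := by exact_mod_cast hN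
    have hqe : (q : ℝ) = q.num / q.den := by exact_mod_cast (Rat.num_div_den q).symm
    have hr1 : 1 / (((N : ℝ) + 1) * q.den) ≤ 1 / (2 * q.den) := by gcongr; linarith
    have hr2 : 1 / (((N : ℝ) + 1) * q.den) ≤ 1 / (q.den * N) := by
      rw [mul_comm]; gcongr; linarith
    have hr3 : 1 / (2 * (N : ℝ)) ≤ 1 / (2 * q.den) := by gcongr
    have hr4 : 1 / (2 * (q.den : ℝ)) + 1 / (2 * q.den) = 1 / q.den := by field_simp; norm_num
    have hr5 : 0 < 1 / (2 * (N : ℝ)) := by positivity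
    have hr6 : 0 < 1 / (2 * (q.den : ℝ)) := by positivity
    obtain ⟨hq1, hq2⟩ := abs_le.1 hq
    obtain ⟨ht1, ht2⟩ := htJ
    have hnum0 : 0 ≤ q.num := by
      by_contra hneg
      have : (q.num : ℝ) ≤ -1 := by exact_mod_cast (by omega : q.num ≤ -1)
      have : (q : ℝ) ≤ -(1 / q.den) := by
        rw [hqe, ← neg_div]; gcongr
      linarith
    obtain ⟨h, hh⟩ := Int.eq_ofNat_of_zero_le hnum0
    have hqe' : (q : ℝ) = (h : ℝ) / q.den := by rw [hqe, hh]; simp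
    have hhk : h ≤ q.den := by
      by_contra hgt
      have : (q.den : ℝ) + 1 ≤ h := by exact_mod_cast (by omega : q.den + 1 ≤ h)
      have : 1 + 1 / (q.den : ℝ) ≤ q := by
        rw [hqe', le_div_iff₀ hkR, add_mul, div_mul_cancel₀ _ hkR.ne']; linarith
      linarith
    have hcop : Nat.Coprime h q.den := by
      have := q.reduced
      rwa [hh, Int.natAbs_natCast] at this
    have hlow : 1 / (2 * q.den * N) ≤ |t - (h : ℝ) / q.den| := by
      by_contra hlt
      obtain ⟨hl1, hl2⟩ := abs_lt.1 (not_le.1 hlt)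
      rcases hhk.lt_or_eq with hh1 | hh1
      · refine htU (Set.mem_iUnion₂.2 ⟨⟨q.den, h⟩, ?_, ?_⟩)
        · simp only [hP, mem_sigma, mem_Icc, mem_filter, mem_range]
          exact ⟨⟨hk, hqN⟩, hh1, hcop⟩
        · simp only [hM, Set.mem_Ioc]
          constructor <;> linarith
      -- The fraction is `1/1`, and `t ≤ 1 - 1/(2N)` rules out `|t - 1| < 1/(2N)`.
      · have h1 : q.den = 1 := by
          rw [hh1] at hcop; simpa using hcop
        rw [hh1, h1] at hl1
        norm_num at hl1
        norm_num at ht2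
        linarith
    refine ⟨⟨q.den, h⟩, ?_, ?_, ?_⟩
    · simp only [hQ, mem_sigma, mem_Icc, mem_range]
      exact ⟨⟨hk, hqN⟩, by omega⟩
    · simp only [hA, Set.mem_Icc]
      rw [← hqe']
      constructor <;> linarith
    · have := hB q.den h hk hqN hcop (t - (h : ℝ) / q.den) hlow
        (by rw [← hqe']; exact hq.trans hr2)
      rwa [add_sub_cancel] at this
  have hSmeas : MeasurableSet S := measurableSet_Ioc.diff hUmeas
  have hAint : ∀ p : Σ _ : ℕ, ℕ, Integrable ((A p).indicator fun _ => B p.1) := fun p =>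
    (integrable_indicator_iff measurableSet_Icc).2 (integrableOn_const (by simp))
  have hmaj : ‖∫ t in S, F t‖ ≤ ∫ t in S, ∑ p ∈ Q, (A p).indicator (fun _ => B p.1) t := by
    refine norm_integral_le_of_norm_le
      (integrable_finsetSum _ fun p _ => (hAint p).integrableOn) ?_
    filter_upwards [ae_restrict_mem hSmeas] with t ht
    obtain ⟨p, hp, htA, hle⟩ := hcover t ht
    refine hle.trans ?_
    have := single_le_sum (s := Q) (f := fun p => (A p).indicator (fun _ => B p.1) t)
      (fun p _ => Set.indicator_nonneg (fun _ _ => hB0 _) t) hp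
    simpa [htA] using this
  refine hmaj.trans ?_
  refine (setIntegral_le_integral (integrable_finsetSum _ fun p _ => hAint p)
    (Eventually.of_forall fun t => sum_nonneg fun p _ =>
      Set.indicator_nonneg (fun _ _ => hB0 _) t)).trans ?_
  rw [integral_finsetSum _ fun p _ => hAint p, hQ, sum_sigma]
  refine sum_le_sum fun k hk => le_of_eq ?_
  have hval : ∀ h : ℕ, ∫ t, (A ⟨k, h⟩).indicator (fun _ => B k) t = B k * (2 / (k * N)) := by
    intro h
    rw [integral_indicator measurableSet_Icc, setIntegral_const, measureReal_def, Real.volume_Icc,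
      ENNReal.toReal_ofReal, smul_eq_mul]
    · ring
    · have : 0 ≤ 1 / ((k : ℝ) * N) := by positivity
      linarith
  simp only [hval, sum_const, card_range, nsmul_eq_mul]
  push_cast; ring

end EtaQuotient

/-! ### The transformed quotient near `1`, dependence on `k` modulo `L`, and the integrand near a
fraction. -/

namespace EtaQuotient

open Complex MeasureTheory Filter Topology

/-- The function is `1` at the origin and has bounded derivative on a closed disk inside the unit
disk. -/
lemma exists_norm_qPochhammer_zpow_sub_one_le (e : ℤ) {c : ℝ} (hc : c < 1) :
    ∃ K : ℝ, 0 ≤ K ∧ ∀ q : ℂ, ‖q‖ ≤ c → ‖qPochhammer q q ^ e - 1‖ ≤ K * ‖q‖ := by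
  set f : ℂ → ℂ := fun q => qPochhammer q q ^ e with hf
  have hd : DifferentiableOn ℂ f (Metric.ball 0 1) := by
    refine DifferentiableOn.zpow ?_ (Or.inl fun q hq => qPochhammer_self_ne_zero (by simpa using hq))
    simp only [qPochhammer_self_eq]
    exact ModularForm.differentiableOn_tprod_one_sub_pow
  have hsub : Metric.closedBall (0 : ℂ) c ⊆ Metric.ball 0 1 := Metric.closedBall_subset_ball hc
  have hcont : ContinuousOn (deriv f) (Metric.closedBall 0 c) :=
    (hd.deriv Metric.isOpen_ball).continuousOn.mono hsub
  obtain ⟨K, hK⟩ := (isCompact_closedBall (0 : ℂ) c).exists_bound_of_continuousOn hcont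
  have h0 : f 0 = 1 := by simp [hf, qPochhammer]
  refine ⟨max K 0, le_max_right _ _, fun q hq => ?_⟩
  have hc0 : 0 ≤ c := (norm_nonneg q).trans hq
  have := (convex_closedBall (0 : ℂ) c).norm_image_sub_le_of_norm_deriv_le
    (fun x hx => hd.differentiableAt (Metric.isOpen_ball.mem_nhds (hsub hx)))
    (fun x hx => (hK x hx).trans (le_max_left K 0)) (Metric.mem_closedBall_self hc0)
    (by simpa using hq : q ∈ Metric.closedBall (0 : ℂ) c)
  rwa [h0, sub_zero] at this

/-- The two bounds on `q` play different roles: `c` confines it to a fixed compact set, which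
determines `K`, while `ε` carries the decay that must beat the exponential growth. -/
lemma exists_norm_prod_qPochhammer_sub_one_le {R : ℕ} (δ : Fin R → ℤ) {c : Fin R → ℝ}
    (hc : ∀ r, c r < 1) : ∃ K : ℝ, 0 ≤ K ∧ ∀ (q : Fin R → ℂ) (ε : ℝ), ε ≤ 1 → 0 ≤ ε →
      (∀ r, ‖q r‖ ≤ c r) → (∀ r, ‖q r‖ ≤ ε) →
      ‖∏ r, qPochhammer (q r) (q r) ^ δ r - 1‖ ≤ K * ε := by
  choose K hK0 hK using fun r => exists_norm_qPochhammer_zpow_sub_one_le (δ r) (hc r)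
  have hS : 0 ≤ ∑ r, K r := sum_nonneg fun r _ => hK0 r
  refine ⟨(∑ r, K r) * Real.exp (∑ r, K r), by positivity, fun q ε hε hε0 h1 h2 => ?_⟩
  have h3 := univ.norm_prod_one_add_sub_one_le fun r => qPochhammer (q r) (q r) ^ δ r - 1
  simp only [add_sub_cancel] at h3
  refine h3.trans ?_
  have h4 : ∑ r, ‖qPochhammer (q r) (q r) ^ δ r - 1‖ ≤ (∑ r, K r) * ε := by
    rw [sum_mul]
    refine sum_le_sum fun r _ => (hK r _ (h1 r)).trans ?_
    have := hK0 r
    have := h2 r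
    gcongr
  have h5 : ∀ x : ℝ, Real.exp x - 1 ≤ x * Real.exp x := fun x => by
    have := mul_le_mul_of_nonneg_right (Real.add_one_le_exp (-x)) (Real.exp_pos x).le
    rw [← Real.exp_add, neg_add_cancel, Real.exp_zero] at this
    linarith
  calc _ ≤ Real.exp ((∑ r, K r) * ε) - 1 := by gcongr
    _ ≤ (∑ r, K r) * ε * Real.exp ((∑ r, K r) * ε) := h5 _
    _ ≤ (∑ r, K r) * ε * Real.exp ((∑ r, K r) * 1) := by gcongr
    _ = _ := by rw [mul_one]; ring

section Periodicity

variable {R : ℕ} {m : Fin R → ℕ} {δ : Fin R → ℤ}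

lemma lcmL_pos (hm : ∀ r, 0 < m r) : 0 < lcmL m := by
  refine Nat.pos_of_ne_zero fun h => ?_
  rw [lcmL, Finset.lcm_eq_zero_iff] at h
  obtain ⟨r, -, hr⟩ := h
  exact (hm r).ne' hr

lemma gcd_eq_of_modEq {k ℓ : ℕ} (h : k ≡ ℓ [MOD lcmL m]) (r : Fin R) :
    (m r).gcd k = (m r).gcd ℓ := by
  have h1 : k ≡ ℓ [MOD m r] := h.of_dvd (Finset.dvd_lcm (mem_univ r))
  rw [Nat.gcd_comm, Nat.gcd_comm (m r)]
  exact h1.gcd_eq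

lemma Delta3_eq_of_modEq {k ℓ : ℕ} (h : k ≡ ℓ [MOD lcmL m]) : Delta3 m δ k = Delta3 m δ ℓ := by
  simp only [Delta3, gcd_eq_of_modEq h]

lemma Delta4_eq_of_modEq {k ℓ : ℕ} (h : k ≡ ℓ [MOD lcmL m]) : Delta4 m δ k = Delta4 m δ ℓ := by
  simp only [Delta4, gcd_eq_of_modEq h]

lemma exists_modEq_mem_Icc (hm : ∀ r, 0 < m r) (k : ℕ) :
    ∃ ℓ ∈ Icc 1 (lcmL m), k ≡ ℓ [MOD lcmL m] := by
  have hL := lcmL_pos hm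
  rcases Nat.eq_zero_or_pos (k % lcmL m) with h | h
  · exact ⟨lcmL m, mem_Icc.2 ⟨hL, le_rfl⟩, by rw [Nat.ModEq, h, Nat.mod_self]⟩
  · exact ⟨k % lcmL m, mem_Icc.2 ⟨h, (Nat.mod_lt _ hL).le⟩, (Nat.mod_modEq _ _).symm⟩

lemma eq_of_modEq_of_mem_Icc {L a b : ℕ} (ha : a ∈ Icc 1 L) (hb : b ∈ Icc 1 L)
    (h : a ≡ b [MOD L]) : a = b := by
  rw [mem_Icc] at ha hb
  rcases ha.2.lt_or_eq with h1 | h1 <;> rcases hb.2.lt_or_eq with h2 | h2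
  · exact h.eq_of_lt_of_lt h1 h2
  · subst h2
    rw [Nat.ModEq, Nat.mod_self, Nat.mod_eq_of_lt h1] at h
    omega
  · subst h1
    rw [Nat.ModEq, Nat.mod_self, Nat.mod_eq_of_lt h2] at h
    omega
  · omega

/-- There are finitely many classes modulo `L`; this bounds `Δ₃` and `Δ₄` uniformly in `k`. -/
lemma exists_bound_of_modEq (hm : ∀ r, 0 < m r) {f : ℕ → ℝ}
    (hf : ∀ k ℓ, k ≡ ℓ [MOD lcmL m] → f k = f ℓ) : ∃ D, 0 ≤ D ∧ ∀ k, f k ≤ D := by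
  refine ⟨∑ ℓ ∈ Icc 1 (lcmL m), |f ℓ|, sum_nonneg fun _ _ => abs_nonneg _, fun k => ?_⟩
  obtain ⟨ℓ, hℓ, h⟩ := exists_modEq_mem_Icc hm k
  rw [hf k ℓ h]
  exact (le_abs_self _).trans (single_le_sum (f := fun ℓ => |f ℓ|) (fun _ _ => abs_nonneg _) hℓ)

lemma Delta4_pos (hm : ∀ r, 0 < m r) (k : ℕ) : 0 < Delta4 m δ k := by
  refine prod_pos fun r _ => Real.rpow_pos_of_pos ?_ _
  have h1 : (0 : ℝ) < m r := by exact_mod_cast hm r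
  have h2 : (0 : ℝ) < (m r).gcd k := by exact_mod_cast Nat.gcd_pos_of_pos_left k (hm r)
  positivity

end Periodicity

lemma norm_omega {R : ℕ} (m : Fin R → ℕ) (δ : Fin R → ℤ) (h k : ℕ) : ‖omega m δ h k‖ = 1 := by
  rw [omega, norm_exp, Real.exp_eq_one_iff]
  simp

/-- The integrand in Cauchy's formula for `g m δ n`. -/
noncomputable def cauchyIntegrand {R : ℕ} (m : Fin R → ℕ) (δ : Fin R → ℤ) (n : ℕ) (ϱ t : ℝ) : ℂ :=
  G m δ (exp (2 * Real.pi * I * (t + I * ϱ))) * exp (-(2 * Real.pi * I * n * (t + I * ϱ)))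

lemma continuous_cauchyIntegrand {R : ℕ} {m : Fin R → ℕ} (δ : Fin R → ℤ) (hm : ∀ r, 0 < m r)
    (n : ℕ) {ϱ : ℝ} (hϱ : 0 < ϱ) : Continuous (cauchyIntegrand m δ n ϱ) := by
  refine Continuous.mul ?_ (by fun_prop)
  refine (differentiableOn_G m δ hm).continuousOn.comp_continuous (by fun_prop) fun t => ?_
  rw [mem_ball_zero_iff, norm_exp, Real.exp_lt_one_iff]
  have := mul_pos Real.pi_pos hϱ
  simp; nlinarith

/-- The quantity `Re (1 / z) / k` for `z = k (ϱ - i y)`. -/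
noncomputable def cuspHeight (k : ℕ) (ϱ y : ℝ) : ℝ := ϱ / (k ^ 2 * (ϱ ^ 2 + y ^ 2))

/-- The integrand near the fraction `h / k`. -/
lemma cauchyIntegrand_eq {R : ℕ} (m : Fin R → ℕ) (δ : Fin R → ℤ) (hm : ∀ r, 0 < m r) {h k : ℕ}
    (hk : 0 < k) (hc : Nat.Coprime h k) (n : ℕ) {ϱ : ℝ} (hϱ : 0 < ϱ) (y : ℝ) :
    ∃ q' : Fin R → ℂ, (∀ r, ‖q' r‖ =
        Real.exp (-2 * Real.pi * (((m r).gcd k : ℝ) ^ 2 / m r) * cuspHeight k ϱ y)) ∧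
      cauchyIntegrand m δ n ϱ (h / k + y) =
      omega m δ h k * exp (2 * Real.pi * I * (-((n : ℂ) * h / k))) *
        ((Delta4 m δ k * (k : ℝ) ^ Delta1 δ : ℝ) : ℂ) *
        lineKernel (-Delta1 δ) (Real.pi * Delta3 m δ k / (12 * k ^ 2))
          (2 * Real.pi * shifted m δ n) ϱ (-y) *
        ∏ r, qPochhammer (q' r) (q' r) ^ δ r := by
  have hkR : (0 : ℝ) < k := by exact_mod_cast hk
  have hkC : (k : ℂ) ≠ 0 := by exact_mod_cast hk.ne'
  have hw := line_re_pos hϱ (-y)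
  have hw0 := line_ne_zero hϱ (-y)
  -- At `t = h/k + y` the variable of `G_transform` is `z = kw` with `w = ϱ - iy`; hence the
  -- argument `-y` of the kernel.
  set w : ℂ := (ϱ : ℂ) + ((-y : ℝ) : ℂ) * I with hwdef
  have hz : 0 < (((k : ℝ) : ℂ) * w).re := by rw [re_ofReal_mul]; positivity
  obtain ⟨q', hq', hG⟩ := G_transform m δ hm hk hc hz
  refine ⟨q', fun r => ?_, ?_⟩
  · rw [hq' r]
    congr 2
    rw [mul_inv, ← ofReal_inv, re_ofReal_mul, inv_re, cuspHeight]
    have h1 : w.re = ϱ := by simp [hwdef]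
    have h2 : normSq w = ϱ ^ 2 + y ^ 2 := by simp [hwdef, normSq_apply]; ring
    rw [h1, h2]
    have : ϱ ^ 2 + y ^ 2 ≠ 0 := by positivity
    field_simp
  · have e1 : ((h / k + y : ℝ) : ℂ) + I * ϱ = (h + I * (((k : ℝ) : ℂ) * w)) / k := by
      rw [hwdef]; push_cast; field_simp
      linear_combination (k * y : ℂ) * I_sq
    have e2 : exp (-(2 * Real.pi * I * n * (((h / k + y : ℝ) : ℂ) + I * ϱ))) =
        exp (2 * Real.pi * I * (-((n : ℂ) * h / k))) * exp (2 * Real.pi * n * w) := by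
      rw [← exp_add, e1]
      congr 1
      push_cast; field_simp
      linear_combination (-(n * w * k) : ℂ) * I_sq
    have e3 : exp (Real.pi / (12 * k) * (Delta3 m δ k / (((k : ℝ) : ℂ) * w) +
        Delta2 m δ * (((k : ℝ) : ℂ) * w))) * exp (2 * Real.pi * n * w) =
        exp (((2 * Real.pi * shifted m δ n : ℝ) : ℂ) * w +
          ((Real.pi * Delta3 m δ k / (12 * k ^ 2) : ℝ) : ℂ) / w) := by
      rw [← exp_add, shifted]
      congr 1
      push_cast; field_simp; ring
    rw [cauchyIntegrand, e2, e1, hG, lineKernel, ← hwdef, ← e3, ofReal_mul_cpow hkR hw,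
      ofReal_mul, ofReal_cpow hkR.le, ofReal_neg, neg_neg]
    ring

end EtaQuotient

/-! ### Pointwise estimates near the fractions `h/k`. -/

namespace EtaQuotient

open Complex MeasureTheory Filter Topology

/-- The choice `ϱ = 1/N²` gives this lower bound on the interval and the annulus alike, which keeps
the nomes `q'` away from the unit circle uniformly. -/
lemma cuspHeight_ge {k N : ℕ} (hk : 0 < k) (hkN : k ≤ N) {y : ℝ} (hy : |y| ≤ 1 / (k * N)) :
    1 / 2 ≤ cuspHeight k (1 / (N : ℝ) ^ 2) y := by
  have hkR : (0 : ℝ) < k := by exact_mod_cast hk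
  have hkNR : (k : ℝ) ≤ N := by exact_mod_cast hkN
  have hNR : (0 : ℝ) < N := hkR.trans_le hkNR
  have h1 : y ^ 2 ≤ (1 / (k * N)) ^ 2 := by rw [← sq_abs y]; gcongr
  rw [cuspHeight, le_div_iff₀ (by positivity)]
  have h2 : (k : ℝ) ^ 2 * ((1 / (N : ℝ) ^ 2) ^ 2 + (1 / (k * N)) ^ 2) ≤ 2 * (1 / (N : ℝ) ^ 2) := by
    have e : (k : ℝ) ^ 2 * ((1 / (N : ℝ) ^ 2) ^ 2 + (1 / (k * N)) ^ 2) =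
        (k / N) ^ 2 * (1 / (N : ℝ) ^ 2) + 1 / (N : ℝ) ^ 2 := by field_simp
    have h3 : ((k : ℝ) / N) ^ 2 ≤ 1 := by
      refine pow_le_one₀ (by positivity) ?_
      rw [div_le_one hNR]; exact hkNR
    rw [e]
    have : 0 < 1 / (N : ℝ) ^ 2 := by positivity
    nlinarith
  have h3 : (k : ℝ) ^ 2 * ((1 / (N : ℝ) ^ 2) ^ 2 + y ^ 2) ≤
    (k : ℝ) ^ 2 * ((1 / (N : ℝ) ^ 2) ^ 2 + (1 / (k * N)) ^ 2) := by gcongr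
  linarith

/-- On the annuli the height is also bounded above, so `exp(πΔ₃/(12kz))` is bounded there whatever
the sign of `Δ₃`. -/
lemma cuspHeight_le {k N : ℕ} (hk : 0 < k) (hN : 0 < N) {y : ℝ} (hy : 1 / (2 * k * N) ≤ |y|) :
    cuspHeight k (1 / (N : ℝ) ^ 2) y ≤ 4 := by
  have hkR : (0 : ℝ) < k := by exact_mod_cast hk
  have hNR : (0 : ℝ) < N := by exact_mod_cast hN
  have h1 : (1 / (2 * k * N)) ^ 2 ≤ y ^ 2 := by rw [← sq_abs y]; gcongr
  rw [cuspHeight, div_le_iff₀ (by positivity)]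
  have h2 : 1 / (N : ℝ) ^ 2 = 4 * (k ^ 2 * (1 / (2 * k * N)) ^ 2) := by field_simp; norm_num
  calc 1 / (N : ℝ) ^ 2 = 4 * (k ^ 2 * (1 / (2 * k * N)) ^ 2) := h2
    _ ≤ 4 * (k ^ 2 * ((1 / (N : ℝ) ^ 2) ^ 2 + y ^ 2)) := by
      gcongr; nlinarith [sq_nonneg (1 / (N : ℝ) ^ 2)]

lemma norm_lineKernel_le_cuspHeight {a D X ϱ y : ℝ} {k : ℕ} (hk : 0 < k) (ha : 0 ≤ a) (hϱ : 0 < ϱ)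
    (hX : X * ϱ ≤ 4) :
    ‖lineKernel a (Real.pi * D / (12 * k ^ 2)) X ϱ (-y)‖ ≤
      ϱ ^ (-a) * (Real.exp 4 * Real.exp (Real.pi * D / 12 * cuspHeight k ϱ y)) := by
  have hkR : (0 : ℝ) < k := by exact_mod_cast hk
  rw [norm_lineKernel, ← Real.exp_add]
  have h0 : ‖(ϱ : ℂ) + ((-y : ℝ) : ℂ) * I‖ ^ (-a) ≤ ϱ ^ (-a) :=
    Real.rpow_le_rpow_of_nonpos hϱ (norm_line_ge ϱ (-y)) (by linarith)
  have h1 : Real.pi * D / (12 * (k : ℝ) ^ 2) * (ϱ / (ϱ ^ 2 + (-y) ^ 2)) =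
      Real.pi * D / 12 * cuspHeight k ϱ y := by
    rw [cuspHeight, neg_sq]
    have : ϱ ^ 2 + y ^ 2 ≠ 0 := by positivity
    field_simp
  rw [h1]
  gcongr

variable {R : ℕ} {m : Fin R → ℕ} {δ : Fin R → ℤ}

/-- The part of the integrand near `h / k` that contributes to the main term. -/
noncomputable def localMain (m : Fin R → ℕ) (δ : Fin R → ℤ) (n h k : ℕ) (ϱ y : ℝ) : ℂ :=
  open Classical in
  if 0 < Delta3 m δ k then
    omega m δ h k * exp (2 * Real.pi * I * (-((n : ℂ) * h / k))) *
      ((Delta4 m δ k * (k : ℝ) ^ Delta1 δ : ℝ) : ℂ) *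
      lineKernel (-Delta1 δ) (Real.pi * Delta3 m δ k / (12 * k ^ 2))
        (2 * Real.pi * shifted m δ n) ϱ (-y)
  else 0

lemma norm_exp_kloosterman (n h k : ℕ) :
    ‖exp (2 * (Real.pi : ℂ) * I * (-((n : ℂ) * h / k)))‖ = 1 := by
  rw [show 2 * (Real.pi : ℂ) * I * (-((n : ℂ) * h / k)) =
    ((2 * Real.pi * (-((n : ℝ) * h / k)) : ℝ) : ℂ) * I by push_cast; ring, norm_exp_ofReal_mul_I]

/-- Pointwise estimates of the integrand near the fractions `h / k`: it differs little from
`localMain`, and it is small away from `h / k`. -/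
lemma exists_local_bound (hm : ∀ r, 0 < m r) (hΔ : Delta1 δ ≤ 0)
    (hmin : ∀ ℓ : ℕ, 1 ≤ ℓ → ℓ ≤ lcmL m → ∀ r : Fin R,
      Delta3 m δ ℓ / 24 ≤ ((m r).gcd ℓ : ℝ) ^ 2 / (m r : ℝ)) :
    ∃ C : ℝ, 0 ≤ C ∧ ∀ n N k h : ℕ, 0 < k → k ≤ N → Nat.Coprime h k →
      2 * Real.pi * shifted m δ n ≤ 4 * (N : ℝ) ^ 2 → ∀ y : ℝ, |y| ≤ 1 / (k * N) →
      ‖cauchyIntegrand m δ n (1 / (N : ℝ) ^ 2) (h / k + y) -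
        localMain m δ n h k (1 / (N : ℝ) ^ 2) y‖ ≤
          C * ((k : ℝ) ^ Delta1 δ * (1 / (N : ℝ) ^ 2) ^ Delta1 δ) ∧
      (1 / (2 * k * N) ≤ |y| → ‖cauchyIntegrand m δ n (1 / (N : ℝ) ^ 2) (h / k + y)‖ ≤
        C * ((k : ℝ) ^ Delta1 δ * (1 / (N : ℝ) ^ 2) ^ Delta1 δ)) := by
  obtain ⟨D3, hD30, hD3⟩ := exists_bound_of_modEq hm (f := Delta3 m δ)
    fun k ℓ h => Delta3_eq_of_modEq h
  obtain ⟨D4, hD40, hD4⟩ := exists_bound_of_modEq hm (f := Delta4 m δ)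
    fun k ℓ h => Delta4_eq_of_modEq h
  obtain ⟨K, hK0, hK⟩ := exists_norm_prod_qPochhammer_sub_one_le δ
    (c := fun r => Real.exp (-(Real.pi / m r))) fun r => by
      have : (0 : ℝ) < m r := by exact_mod_cast hm r
      rw [Real.exp_lt_one_iff, neg_lt_zero]
      positivity
  refine ⟨D4 * (Real.exp 4 * Real.exp (Real.pi * D3 / 12 * 4) * (K + 1)), by positivity,
    fun n N k h hk hkN hc hX y hy => ?_⟩
  have hkR : (0 : ℝ) < k := by exact_mod_cast hk
  have hN : 0 < N := hk.trans_le hkN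
  have hNR : (0 : ℝ) < N := by exact_mod_cast hN
  have hpi := Real.pi_pos
  set ϱ : ℝ := 1 / (N : ℝ) ^ 2 with hϱdef
  have hϱ : 0 < ϱ := by positivity
  have hXϱ : 2 * Real.pi * shifted m δ n * ϱ ≤ 4 := by
    rw [hϱdef, mul_one_div, div_le_iff₀ (by positivity)]; exact hX
  have hY := cuspHeight_ge hk hkN hy
  rw [← hϱdef] at hY
  set Y := cuspHeight k ϱ y with hYdef
  obtain ⟨q', hq', hF⟩ := cauchyIntegrand_eq m δ hm hk hc n hϱ y
  rw [← hYdef] at hq'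
  have hD4k := Delta4_pos (δ := δ) hm k
  have hker := norm_lineKernel_le_cuspHeight (a := -Delta1 δ) (D := Delta3 m δ k) (y := y)
    hk (by linarith) hϱ hXϱ
  rw [neg_neg, ← hYdef] at hker
  have hq1 : ∀ r, ‖q' r‖ ≤ Real.exp (-(Real.pi / m r)) := by
    intro r
    rw [hq' r]
    have hmr : (0 : ℝ) < m r := by exact_mod_cast hm r
    have hg : (1 : ℝ) ≤ (m r).gcd k := by exact_mod_cast Nat.gcd_pos_of_pos_left k (hm r)
    gcongr
    have h1 : 1 / (m r : ℝ) ≤ ((m r).gcd k : ℝ) ^ 2 / m r := by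
      gcongr; nlinarith
    have h2 : 1 / (m r : ℝ) * (1 / 2) ≤ ((m r).gcd k : ℝ) ^ 2 / m r * Y := by gcongr
    have h3 : Real.pi / (m r : ℝ) = 2 * Real.pi * (1 / (m r : ℝ) * (1 / 2)) := by ring
    nlinarith
  set pre : ℂ := omega m δ h k * exp (2 * Real.pi * I * (-((n : ℂ) * h / k))) *
        ((Delta4 m δ k * (k : ℝ) ^ Delta1 δ : ℝ) : ℂ) *
        lineKernel (-Delta1 δ) (Real.pi * Delta3 m δ k / (12 * k ^ 2))
          (2 * Real.pi * shifted m δ n) ϱ (-y) with hpre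
  set Q : ℂ := ∏ r, qPochhammer (q' r) (q' r) ^ δ r with hQ
  set V : ℝ := (k : ℝ) ^ Delta1 δ * ϱ ^ Delta1 δ with hV
  have hV0 : 0 < V := by positivity
  have hnpre : ‖pre‖ ≤ D4 * V * (Real.exp 4 * Real.exp (Real.pi * Delta3 m δ k / 12 * Y)) := by
    rw [hpre, norm_mul, norm_mul, norm_mul, norm_omega, norm_exp_kloosterman, norm_real,
      Real.norm_of_nonneg (by positivity), one_mul, one_mul]
    calc _ ≤ D4 * (k : ℝ) ^ Delta1 δ *
        (ϱ ^ Delta1 δ * (Real.exp 4 * Real.exp (Real.pi * Delta3 m δ k / 12 * Y))) := by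
          have := hD4 k
          gcongr
      _ = _ := by rw [hV]; ring
  have hQ1 : ‖Q‖ ≤ K + 1 := by
    have h1 := hK q' 1 le_rfl zero_le_one hq1 fun r => (hq1 r).trans (by
      rw [Real.exp_le_one_iff, neg_nonpos]; positivity)
    have h2 := norm_add_le (Q - 1) 1
    rw [sub_add_cancel, norm_one] at h2
    linarith
  have hexp1 : 1 ≤ Real.exp (Real.pi * D3 / 12 * 4) := Real.one_le_exp (by positivity)
  -- the bound for the whole integrand, when the exponential factor is bounded
  have hwhole : Real.pi * Delta3 m δ k / 12 * Y ≤ Real.pi * D3 / 12 * 4 →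
      ‖pre * Q‖ ≤ D4 * (Real.exp 4 * Real.exp (Real.pi * D3 / 12 * 4) * (K + 1)) * V := by
    intro hle
    rw [norm_mul]
    calc ‖pre‖ * ‖Q‖ ≤ D4 * V * (Real.exp 4 * Real.exp (Real.pi * Delta3 m δ k / 12 * Y)) *
          (K + 1) := by gcongr
      _ ≤ D4 * V * (Real.exp 4 * Real.exp (Real.pi * D3 / 12 * 4)) * (K + 1) := by gcongr
      _ = _ := by ring
  rw [hF]
  constructor
  · rw [localMain]
    split_ifs with h3
    · rw [← hpre, show pre * Q - pre = pre * (Q - 1) by ring, norm_mul]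
      have hε : Real.exp (-(Real.pi * Delta3 m δ k / 12 * Y)) ≤ 1 := by
        rw [Real.exp_le_one_iff, neg_nonpos]; positivity
      -- This is where `hmin` enters: `2π gcd²/m_r ≥ πΔ₃/12`, so `Q - 1` is small enough to cancel
      -- the exponential growth of `pre`.
      have hqε : ∀ r, ‖q' r‖ ≤ Real.exp (-(Real.pi * Delta3 m δ k / 12 * Y)) := by
        intro r
        rw [hq' r]
        obtain ⟨ℓ, hℓ, hkℓ⟩ := exists_modEq_mem_Icc hm k
        rw [mem_Icc] at hℓ
        have h4 := hmin ℓ hℓ.1 hℓ.2 r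
        rw [← Delta3_eq_of_modEq hkℓ, ← gcd_eq_of_modEq hkℓ r] at h4
        gcongr
        have h5 : Delta3 m δ k / 24 * Y ≤ ((m r).gcd k : ℝ) ^ 2 / m r * Y := by gcongr
        have h6 : Real.pi * Delta3 m δ k / 12 * Y = 2 * Real.pi * (Delta3 m δ k / 24 * Y) := by
          ring
        nlinarith
      have h7 := hK q' _ hε (Real.exp_pos _).le hq1 hqε
      calc ‖pre‖ * ‖Q - 1‖ ≤ D4 * V * (Real.exp 4 * Real.exp (Real.pi * Delta3 m δ k / 12 * Y)) *
            (K * Real.exp (-(Real.pi * Delta3 m δ k / 12 * Y))) := by gcongr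
        _ = D4 * (Real.exp 4 * 1 * K) * V * (Real.exp (Real.pi * Delta3 m δ k / 12 * Y) *
            Real.exp (-(Real.pi * Delta3 m δ k / 12 * Y))) := by ring
        _ = D4 * (Real.exp 4 * 1 * K) * V := by
          rw [← Real.exp_add, add_neg_cancel, Real.exp_zero, mul_one]
        _ ≤ D4 * (Real.exp 4 * Real.exp (Real.pi * D3 / 12 * 4) * (K + 1)) * V := by
          gcongr; linarith
    · rw [sub_zero]
      refine hwhole ?_
      -- If `Δ₃ ≤ 0` the exponential does not grow, and the whole integrand counts as error.
      have : Real.pi * Delta3 m δ k / 12 * Y ≤ 0 :=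
        mul_nonpos_of_nonpos_of_nonneg (by nlinarith) (by linarith)
      exact this.trans (by positivity)
  · intro hy2
    refine hwhole ?_
    have hY4 : Y ≤ 4 := cuspHeight_le hk hN hy2
    have := hD3 k
    calc Real.pi * Delta3 m δ k / 12 * Y ≤ Real.pi * D3 / 12 * Y := by gcongr
      _ ≤ _ := by gcongr

end EtaQuotient

/-! ### The main term from the local integrals. -/

namespace EtaQuotient

open Complex MeasureTheory Filter Topology

variable {R : ℕ} {m : Fin R → ℕ} {δ : Fin R → ℤ}

/-- The contribution of the denominator `k` to the main term, apart from the Kloosterman sum. -/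
noncomputable def mainSummand (m : Fin R → ℕ) (δ : Fin R → ℤ) (n k : ℕ) : ℂ :=
  open Classical in
  if 0 < Delta3 m δ k then
    ((2 * Real.pi * Delta4 m δ k *
      ((24 * (n : ℝ) + Delta2 m δ) / Delta3 m δ k) ^ (-((Delta1 δ + 1) / 2)) : ℝ) : ℂ) *
    ((besselI (-Delta1 δ - 1)
        (Real.pi / (6 * k) * Real.sqrt (Delta3 m δ k * (24 * (n : ℝ) + Delta2 m δ))) / k : ℝ) : ℂ)
  else 0

/-- Each `k` is congruent to exactly one `ℓ` in `1, …, L`, and `Δ₃`, `Δ₄` depend only on that class,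
so the double sum collapses to one over `k`. -/
lemma mainTerm_eq_sum (hm : ∀ r, 0 < m r) (n : ℕ) :
    mainTerm m δ n = ∑ k ∈ Icc 1 (cutoff m δ n), mainSummand m δ n k * kloostermanSum m δ n k := by
  classical
  rw [mainTerm]
  simp_rw [mul_sum, sum_filter]
  rw [sum_comm]
  refine sum_congr rfl fun k _ => ?_
  obtain ⟨ℓ, hℓ, hkℓ⟩ := exists_modEq_mem_Icc hm k
  by_cases h3 : 0 < Delta3 m δ k
  · have hmem : ℓ ∈ Lpos m δ := by
      rw [Lpos, mem_filter, ← Delta3_eq_of_modEq hkℓ]; exact ⟨hℓ, h3⟩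
    rw [sum_eq_single_of_mem ℓ hmem fun x hx hne => if_neg fun hkx => hne
      (eq_of_modEq_of_mem_Icc (mem_of_mem_filter x hx) hℓ (hkx.symm.trans hkℓ)), if_pos hkℓ,
      mainSummand, if_pos h3, ← Delta3_eq_of_modEq hkℓ, ← Delta4_eq_of_modEq hkℓ]
    ring
  · rw [mainSummand, if_neg h3, zero_mul]
    refine sum_eq_zero fun x hx => if_neg fun hkx => h3 ?_
    rw [Delta3_eq_of_modEq hkx]
    exact (mem_filter.1 hx).2

lemma rpow_sq_div {c k s : ℝ} (hc : 0 < c) (hk : 0 < k) :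
    (c * k ^ 2) ^ s = c ^ s * k ^ (2 * s) := by
  rw [Real.mul_rpow hc.le (by positivity), ← Real.rpow_natCast, ← Real.rpow_mul hk.le]
  norm_num

/-- Here `X/A = (24n + Δ₂)k²/Δ₃` and `2√(AX)` is the Bessel argument of the theorem; the powers of
`k` combine to `1/k`. -/
lemma bessel_main_value {n k : ℕ} (hk : 0 < k) (hx : 0 < shifted m δ n)
    (h3 : 0 < Delta3 m δ k) :
    Delta4 m δ k * (k : ℝ) ^ Delta1 δ * ∑' j, besselTerm (-Delta1 δ)
      (Real.pi * Delta3 m δ k / (12 * k ^ 2)) (2 * Real.pi * shifted m δ n) j =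
    (2 * Real.pi * Delta4 m δ k *
      ((24 * (n : ℝ) + Delta2 m δ) / Delta3 m δ k) ^ (-((Delta1 δ + 1) / 2))) *
    (besselI (-Delta1 δ - 1)
        (Real.pi / (6 * k) * Real.sqrt (Delta3 m δ k * (24 * (n : ℝ) + Delta2 m δ))) / k) := by
  have hkR : (0 : ℝ) < k := by exact_mod_cast hk
  have hpi := Real.pi_pos
  have h24 : 24 * (n : ℝ) + Delta2 m δ = 24 * shifted m δ n := by rw [shifted]; ring
  rw [tsum_besselTerm (by positivity) (by positivity), h24]
  have e1 : 2 * Real.pi * shifted m δ n / (Real.pi * Delta3 m δ k / (12 * k ^ 2)) =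
      24 * shifted m δ n / Delta3 m δ k * (k : ℝ) ^ 2 := by
    field_simp; norm_num
  have e2 : 2 * Real.sqrt (Real.pi * Delta3 m δ k / (12 * k ^ 2) * (2 * Real.pi * shifted m δ n)) =
      Real.pi / (6 * k) * Real.sqrt (Delta3 m δ k * (24 * shifted m δ n)) := by
    have h1 : Real.pi * Delta3 m δ k / (12 * k ^ 2) * (2 * Real.pi * shifted m δ n) =
        (Real.pi / (12 * k)) ^ 2 * (Delta3 m δ k * (24 * shifted m δ n)) := by
      field_simp; norm_num
    rw [h1, Real.sqrt_mul (by positivity), Real.sqrt_sq (by positivity)]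
    field_simp; norm_num
  rw [e1, e2, rpow_sq_div (by positivity) hkR,
    show (-Delta1 δ - 1) / 2 = -((Delta1 δ + 1) / 2) by ring,
    show 2 * -((Delta1 δ + 1) / 2) = -Delta1 δ - 1 by ring]
  have e3 : (k : ℝ) ^ Delta1 δ * (k : ℝ) ^ (-Delta1 δ - 1) = 1 / k := by
    rw [← Real.rpow_add hkR, show Delta1 δ + (-Delta1 δ - 1) = -1 by ring, Real.rpow_neg_one,
      one_div]
  linear_combination (2 * Real.pi * Delta4 m δ k *
    (24 * shifted m δ n / Delta3 m δ k) ^ (-((Delta1 δ + 1) / 2)) *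
    besselI (-Delta1 δ - 1)
      (Real.pi / (6 * k) * Real.sqrt (Delta3 m δ k * (24 * shifted m δ n)))) * e3

/-- The integral of `localMain` around `h / k`. -/
lemma exists_integral_localMain_bound (hm : ∀ r, 0 < m r) (hΔ : Delta1 δ ≤ 0) :
    ∃ C : ℝ, 0 ≤ C ∧ ∀ n N k h : ℕ, 0 < k → k ≤ N →
      (N : ℝ) ^ 2 ≤ 2 * Real.pi * shifted m δ n →
      2 * Real.pi * shifted m δ n ≤ 4 * (N : ℝ) ^ 2 →
      ‖(∫ y in -(1 / (2 * (k : ℝ) * N))..1 / (2 * k * N),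
          localMain m δ n h k (1 / (N : ℝ) ^ 2) y) -
        mainSummand m δ n k * (omega m δ h k * exp (2 * Real.pi * I * (-((n : ℂ) * h / k))))‖ ≤
      C * ((N : ℝ) ^ (-Delta1 δ - 1) / k) := by
  obtain ⟨D3, hD30, hD3⟩ := exists_bound_of_modEq hm (f := Delta3 m δ)
    fun k ℓ h => Delta3_eq_of_modEq h
  obtain ⟨D4, hD40, hD4⟩ := exists_bound_of_modEq hm (f := Delta4 m δ)
    fun k ℓ h => Delta4_eq_of_modEq h
  -- This `K` meets all four constraints for `ϱ = 1/N²`, `θ = 1/(2kN)`: `Xϱ ≤ 4`, `Aϱ = (πΔ₃/3)θ²`,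
  -- `A = (πΔ₃/3)N²θ²` with `N² ≤ X`, and `θX ≥ 1/2`.
  obtain ⟨C, hC0, hC⟩ := exists_truncatedBound (K := 4 + Real.pi * D3 / 3) (a := -Delta1 δ)
    (by positivity) (by linarith)
  refine ⟨D4 * C * 2 ^ (-Delta1 δ - 1), by positivity, fun n N k h hk hkN hX1 hX2 => ?_⟩
  have hkR : (0 : ℝ) < k := by exact_mod_cast hk
  have hkNR : (k : ℝ) ≤ N := by exact_mod_cast hkN
  have hNR : (0 : ℝ) < N := hkR.trans_le hkNR
  have hpi := Real.pi_pos
  rw [mainSummand]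
  simp only [localMain]
  split_ifs with h3
  swap
  · simp; positivity
  have hx : 0 < shifted m δ n := by
    have h1 : 0 < 2 * Real.pi * shifted m δ n := lt_of_lt_of_le (by positivity) hX1
    exact pos_of_mul_pos_right h1 (by positivity)
  rw [← ofReal_mul, ← bessel_main_value hk hx h3, intervalIntegral.integral_const_mul,
    intervalIntegral.integral_comp_neg (fun y => lineKernel (-Delta1 δ)
      (Real.pi * Delta3 m δ k / (12 * k ^ 2)) (2 * Real.pi * shifted m δ n) (1 / (N : ℝ) ^ 2) y),
    neg_neg]
  have hb := hC (1 / (N : ℝ) ^ 2) (1 / (2 * k * N)) (2 * Real.pi * shifted m δ n)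
    (Real.pi * Delta3 m δ k / (12 * k ^ 2)) (by positivity) (by positivity) (by positivity)
    (by positivity) ?_ ?_ ?_ ?_
  · set T := ∑' j, besselTerm (-Delta1 δ) (Real.pi * Delta3 m δ k / (12 * k ^ 2))
      (2 * Real.pi * shifted m δ n) j
    set J := ∫ y in -(1 / (2 * (k : ℝ) * N))..1 / (2 * k * N), lineKernel (-Delta1 δ)
      (Real.pi * Delta3 m δ k / (12 * k ^ 2)) (2 * Real.pi * shifted m δ n) (1 / (N : ℝ) ^ 2) y
    set W := omega m δ h k * exp (2 * Real.pi * I * (-((n : ℂ) * h / k))) with hW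
    have hWn : ‖W‖ = 1 := by rw [hW, norm_mul, norm_omega, norm_exp_kloosterman, one_mul]
    have e : W * ((Delta4 m δ k * (k : ℝ) ^ Delta1 δ : ℝ) : ℂ) * J -
        ((Delta4 m δ k * (k : ℝ) ^ Delta1 δ * T : ℝ) : ℂ) * W =
        W * ((Delta4 m δ k * (k : ℝ) ^ Delta1 δ : ℝ) : ℂ) * (J - T) := by
      push_cast; ring
    have hD4k := Delta4_pos (δ := δ) hm k
    rw [e, norm_mul, norm_mul, hWn, one_mul, norm_real, Real.norm_of_nonneg (by positivity)]
    have e2 : (k : ℝ) ^ Delta1 δ * (1 / (2 * k * N)) ^ (1 - -Delta1 δ) =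
        2 ^ (-Delta1 δ - 1) * ((N : ℝ) ^ (-Delta1 δ - 1) / k) := by
      rw [one_div, Real.inv_rpow (by positivity), ← Real.rpow_neg (by positivity),
        show -(1 - -Delta1 δ) = -Delta1 δ - 1 by ring, Real.mul_rpow (by positivity) hNR.le,
        Real.mul_rpow (by positivity) hkR.le]
      have e3 : (k : ℝ) ^ Delta1 δ * (k : ℝ) ^ (-Delta1 δ - 1) = 1 / k := by
        rw [← Real.rpow_add hkR, show Delta1 δ + (-Delta1 δ - 1) = -1 by ring, Real.rpow_neg_one,
          one_div]
      linear_combination (2 ^ (-Delta1 δ - 1) * (N : ℝ) ^ (-Delta1 δ - 1)) * e3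
    calc _ ≤ D4 * (k : ℝ) ^ Delta1 δ * (C * (1 / (2 * k * N)) ^ (1 - -Delta1 δ)) := by
          have := hD4 k
          gcongr
      _ = D4 * C * ((k : ℝ) ^ Delta1 δ * (1 / (2 * k * N)) ^ (1 - -Delta1 δ)) := by ring
      _ = _ := by rw [e2]; ring
  · rw [mul_one_div, div_le_iff₀ (by positivity)]
    have : 0 ≤ Real.pi * D3 / 3 * (N : ℝ) ^ 2 := by positivity
    linarith
  · have e1 : Real.pi * Delta3 m δ k / (12 * k ^ 2) * (1 / (N : ℝ) ^ 2) =
        Real.pi * Delta3 m δ k / 3 * (1 / (2 * k * N)) ^ 2 := by field_simp; norm_num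
    rw [e1]
    gcongr
    have := hD3 k
    calc Real.pi * Delta3 m δ k / 3 ≤ Real.pi * D3 / 3 := by gcongr
      _ ≤ _ := by linarith
  · have e1 : Real.pi * Delta3 m δ k / (12 * k ^ 2) =
        Real.pi * Delta3 m δ k / 3 * (N : ℝ) ^ 2 * (1 / (2 * k * N)) ^ 2 := by
      field_simp; norm_num
    rw [e1]
    have := hD3 k
    gcongr
    calc Real.pi * Delta3 m δ k / 3 ≤ Real.pi * D3 / 3 := by gcongr
      _ ≤ _ := by linarith
  · have h1 : 1 / 2 ≤ 1 / (2 * (k : ℝ) * N) * (2 * Real.pi * shifted m δ n) := by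
      rw [div_mul_eq_mul_div, one_mul, le_div_iff₀ (by positivity)]
      nlinarith
    have h2 : 0 ≤ Real.pi * D3 / 3 := by positivity
    nlinarith

end EtaQuotient

/-! ### Summation of the errors and comparison with the stated bound. -/

namespace EtaQuotient

open Complex MeasureTheory Filter Topology

variable {R : ℕ} {m : Fin R → ℕ} {δ : Fin R → ℤ}

lemma continuous_localMain (n h k : ℕ) {ϱ : ℝ} (hϱ : 0 < ϱ) :
    Continuous (localMain m δ n h k ϱ) := by
  unfold localMain
  split_ifs
  · exact continuous_const.mul ((continuous_lineKernel _ _ _ hϱ).comp continuous_neg)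
  · exact continuous_const

/-- The error term in terms of the cutoff. -/
theorem exists_norm_g_sub_mainTerm_le (hm : ∀ r, 0 < m r) (hΔ : Delta1 δ ≤ 0)
    (hmin : ∀ ℓ : ℕ, 1 ≤ ℓ → ℓ ≤ lcmL m → ∀ r : Fin R,
      Delta3 m δ ℓ / 24 ≤ ((m r).gcd ℓ : ℝ) ^ 2 / (m r : ℝ)) :
    ∃ C : ℝ, 0 ≤ C ∧ ∀ n N : ℕ, N = cutoff m δ n → 0 < N →
      (N : ℝ) ^ 2 ≤ 2 * Real.pi * shifted m δ n →
      2 * Real.pi * shifted m δ n ≤ 4 * (N : ℝ) ^ 2 →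
      ‖g m δ n - mainTerm m δ n‖ ≤ C * ((N : ℝ) ^ (-Delta1 δ) +
        (N : ℝ) ^ (-2 * Delta1 δ - 1) * ∑ k ∈ Icc 1 N, (k : ℝ) ^ Delta1 δ) := by
  obtain ⟨C₁, hC₁0, hC₁⟩ := exists_local_bound hm hΔ hmin
  obtain ⟨C₂, hC₂0, hC₂⟩ := exists_integral_localMain_bound (δ := δ) hm hΔ
  -- The annuli contribute `4 C₁`, the passage to `localMain` contributes `C₁`, and the truncation
  -- of the Hankel integrals `C₂`.
  refine ⟨5 * C₁ + C₂, by positivity, fun n N hNdef hN hX1 hX2 => ?_⟩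
  have hNR : (0 : ℝ) < N := by exact_mod_cast hN
  set ϱ : ℝ := 1 / (N : ℝ) ^ 2 with hϱdef
  have hϱ : 0 < ϱ := by positivity
  set F := cauchyIntegrand m δ n ϱ with hF
  have hFc : Continuous F := continuous_cauchyIntegrand δ hm n hϱ
  set V : ℕ → ℝ := fun k => (k : ℝ) ^ Delta1 δ * ϱ ^ Delta1 δ with hV
  have hV0 : ∀ k, 0 ≤ V k := fun k => by positivity
  have hVN : ∀ k, V k / N = (N : ℝ) ^ (-2 * Delta1 δ - 1) * (k : ℝ) ^ Delta1 δ := by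
    intro k
    rw [hV, hϱdef]
    simp only
    rw [one_div, Real.inv_rpow (by positivity), ← Real.rpow_natCast (N : ℝ) 2,
      ← Real.rpow_mul hNR.le, ← Real.rpow_neg hNR.le, Real.rpow_sub_one hNR.ne',
      show -(((2 : ℕ) : ℝ) * Delta1 δ) = -2 * Delta1 δ by push_cast; ring]
    ring
  have hg : g m δ n = ∫ t in -(1 / (2 * (N : ℝ)))..-(1 / (2 * (N : ℝ))) + 1, F t :=
    (coeff_eq_integral (fun q hq => hasSum_g m δ hm hq) n hϱ _).symm
  have hd := norm_integral_sub_sum_le hFc hN (B := fun k => C₁ * V k)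
    (fun k => mul_nonneg hC₁0 (hV0 k))
    fun k h hk hkN hc y hy1 hy2 => (hC₁ n N k h hk hkN hc hX2 y hy2).2 hy1
  rw [← hg] at hd
  set D := ∑ k ∈ Icc 1 N, ∑ h ∈ (range k).filter (fun h => Nat.gcd h k = 1),
        ∫ y in -(1 / (2 * (k : ℝ) * N))..1 / (2 * k * N), F (h / k + y) with hD
  have hlocal : ‖D - mainTerm m δ n‖ ≤
      ∑ k ∈ Icc 1 N, (k : ℝ) * (C₁ * V k * (1 / (k * N)) +
        C₂ * ((N : ℝ) ^ (-Delta1 δ - 1) / k)) := by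
    rw [mainTerm_eq_sum hm, ← hNdef, hD, ← sum_sub_distrib]
    refine norm_sum_le_of_le _ fun k hk => ?_
    obtain ⟨hk0, hkN⟩ := mem_Icc.1 hk
    have hkR : (0 : ℝ) < k := by exact_mod_cast hk0
    rw [kloostermanSum, mul_sum, ← sum_sub_distrib]
    have hterm : ∀ h ∈ (range k).filter (fun h => Nat.gcd h k = 1),
        ‖(∫ y in -(1 / (2 * (k : ℝ) * N))..1 / (2 * k * N), F (h / k + y)) -
          mainSummand m δ n k * (omega m δ h k *
            exp (2 * (Real.pi : ℂ) * I * (-((n : ℂ) * h / k))))‖ ≤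
        C₁ * V k * (1 / (k * N)) + C₂ * ((N : ℝ) ^ (-Delta1 δ - 1) / k) := by
      intro h hh
      have hc : Nat.Coprime h k := (mem_filter.1 hh).2
      refine (norm_sub_le_norm_sub_add_norm_sub _ (∫ y in -(1 / (2 * (k : ℝ) * N))..1 / (2 * k * N),
        localMain m δ n h k ϱ y) _).trans (add_le_add ?_ (hC₂ n N k h hk0 hkN hX1 hX2))
      have hFh : Continuous fun y : ℝ => F (h / k + y) := hFc.comp (by fun_prop)
      rw [← intervalIntegral.integral_sub (hFh.intervalIntegrable _ _)
        ((continuous_localMain n h k hϱ).intervalIntegrable _ _)]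
      have hθ : 0 ≤ 1 / (2 * (k : ℝ) * N) := by positivity
      have := intervalIntegral.norm_integral_le_of_norm_le_const
        (f := fun y => F (h / k + y) - localMain m δ n h k ϱ y)
        (a := -(1 / (2 * (k : ℝ) * N))) (b := 1 / (2 * k * N)) (C := C₁ * V k) fun y hy => by
          rw [Set.uIoc_of_le (by linarith)] at hy
          refine (hC₁ n N k h hk0 hkN hc hX2 y ?_).1
          have h1 : 1 / (2 * (k : ℝ) * N) ≤ 1 / (k * N) := by
            gcongr; linarith
          rw [abs_le]
          constructor <;> linarith [hy.1, hy.2]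
      refine this.trans (le_of_eq ?_)
      rw [sub_neg_eq_add, abs_of_nonneg (by positivity)]
      congr 1
      field_simp; norm_num
    refine (norm_sum_le_of_le _ hterm).trans ?_
    rw [sum_const, nsmul_eq_mul]
    -- Trivial estimate: at most `k` numerators, without any cancellation in the Kloosterman sums.
    have hcard : (#((range k).filter (fun h => Nat.gcd h k = 1)) : ℝ) ≤ k := by
      exact_mod_cast (card_filter_le _ _).trans (card_range k).le
    have := hV0 k
    gcongr
  have hsum1 : ∑ k ∈ Icc 1 N, ((k : ℝ) + 1) * (C₁ * V k * (2 / (k * N))) ≤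
      4 * C₁ * ((N : ℝ) ^ (-2 * Delta1 δ - 1) * ∑ k ∈ Icc 1 N, (k : ℝ) ^ Delta1 δ) := by
    rw [mul_sum, mul_sum]
    refine sum_le_sum fun k hk => ?_
    have hkR : (1 : ℝ) ≤ k := by exact_mod_cast (mem_Icc.1 hk).1
    rw [← hVN k]
    have hv := hV0 k
    calc ((k : ℝ) + 1) * (C₁ * V k * (2 / (k * N))) ≤ (2 * k) * (C₁ * V k * (2 / (k * N))) := by
          gcongr; linarith
      _ = 4 * C₁ * (V k / N) := by field_simp; ring
  have hsum2 : ∑ k ∈ Icc 1 N, (k : ℝ) * (C₁ * V k * (1 / (k * N)) +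
        C₂ * ((N : ℝ) ^ (-Delta1 δ - 1) / k)) =
      C₁ * ((N : ℝ) ^ (-2 * Delta1 δ - 1) * ∑ k ∈ Icc 1 N, (k : ℝ) ^ Delta1 δ) +
        C₂ * (N : ℝ) ^ (-Delta1 δ) := by
    have h1 : ∀ k ∈ Icc 1 N, (k : ℝ) * (C₁ * V k * (1 / (k * N)) +
        C₂ * ((N : ℝ) ^ (-Delta1 δ - 1) / k)) =
        C₁ * ((N : ℝ) ^ (-2 * Delta1 δ - 1) * (k : ℝ) ^ Delta1 δ) +
          C₂ * (N : ℝ) ^ (-Delta1 δ - 1) := by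
      intro k hk
      have hkR : (0 : ℝ) < k := by exact_mod_cast (mem_Icc.1 hk).1
      rw [← hVN k]; field_simp
    rw [sum_congr rfl h1, sum_add_distrib, ← mul_sum, ← mul_sum, sum_const, Nat.card_Icc,
      nsmul_eq_mul, Nat.add_sub_cancel]
    have h2 : (N : ℝ) * (N : ℝ) ^ (-Delta1 δ - 1) = (N : ℝ) ^ (-Delta1 δ) := by
      rw [Real.rpow_sub_one hNR.ne', mul_div_cancel₀ _ hNR.ne']
    linear_combination C₂ * h2
  have hN1 : 0 ≤ (N : ℝ) ^ (-Delta1 δ) := by positivity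
  calc _ ≤ ‖g m δ n - D‖ + ‖D - mainTerm m δ n‖ := norm_sub_le_norm_sub_add_norm_sub _ _ _
    _ ≤ 4 * C₁ * ((N : ℝ) ^ (-2 * Delta1 δ - 1) * ∑ k ∈ Icc 1 N, (k : ℝ) ^ Delta1 δ) +
        (C₁ * ((N : ℝ) ^ (-2 * Delta1 δ - 1) * ∑ k ∈ Icc 1 N, (k : ℝ) ^ Delta1 δ) +
        C₂ * (N : ℝ) ^ (-Delta1 δ)) :=
      add_le_add (hd.trans hsum1) (hlocal.trans hsum2.le)
    _ ≤ _ := by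
      have h1 : 0 ≤ (N : ℝ) ^ (-2 * Delta1 δ - 1) * ∑ k ∈ Icc 1 N, (k : ℝ) ^ Delta1 δ :=
        mul_nonneg (by positivity) (sum_nonneg fun k _ => by positivity)
      nlinarith [mul_nonneg hC₁0 hN1, mul_nonneg hC₂0 h1]

lemma sum_inv_sqrt_le (N : ℕ) : ∑ k ∈ Icc 1 N, (k : ℝ) ^ (-1 / 2 : ℝ) ≤ 2 * Real.sqrt N := by
  induction N with
  | zero => simp
  | succ N ih =>
    rw [sum_Icc_succ_top (by omega)]
    have h1 : ((N + 1 : ℕ) : ℝ) ^ (-1 / 2 : ℝ) = 1 / Real.sqrt ((N + 1 : ℕ) : ℝ) := by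
      rw [neg_div, Real.rpow_neg (by positivity), ← Real.sqrt_eq_rpow, one_div]
    have h2 : 0 < Real.sqrt ((N + 1 : ℕ) : ℝ) := Real.sqrt_pos.2 (by positivity)
    have h3 := Real.sq_sqrt (show (0 : ℝ) ≤ ((N + 1 : ℕ) : ℝ) by positivity)
    have h4 := Real.sq_sqrt (show (0 : ℝ) ≤ (N : ℝ) by positivity)
    push_cast at h3 h1 h2 ⊢
    rw [h1]
    have h5 : 1 / Real.sqrt ((N : ℝ) + 1) ≤ 2 * (Real.sqrt (N + 1) - Real.sqrt N) := by
      rw [div_le_iff₀ h2]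
      nlinarith [sq_nonneg (Real.sqrt ((N : ℝ) + 1) - Real.sqrt N)]
    linarith

lemma rpow_le_of_sq_le {N x s : ℝ} (hN : 0 < N) (hs : 0 ≤ s) (hx : 0 ≤ x)
    (h : N ^ 2 ≤ 2 * Real.pi * x) : N ^ (2 * s) ≤ (2 * Real.pi) ^ s * x ^ s := by
  rw [← Real.mul_rpow (by positivity) hx, Real.rpow_mul hN.le]
  refine Real.rpow_le_rpow (by positivity) ?_ hs
  exact_mod_cast h

/-- The sum of the error contributions of all denominators is of the stated order. -/
lemma exists_le_errorBound {S : ℕ} {D : ℝ} (hD : D = -(S : ℝ) / 2) :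
    ∃ C : ℝ, 0 ≤ C ∧ ∀ (N : ℕ) (x : ℝ), 0 < N → 8 ≤ x → (N : ℝ) ^ 2 ≤ 2 * Real.pi * x →
      (N : ℝ) ^ (-D) + (N : ℝ) ^ (-2 * D - 1) * ∑ k ∈ Icc 1 N, (k : ℝ) ^ D ≤
        C * errorBound D x := by
  have hpi := Real.pi_pos
  rcases (by omega : S = 0 ∨ S = 1 ∨ S = 2 ∨ 3 ≤ S) with rfl | rfl | rfl | hS
  · obtain rfl : D = 0 := by simp [hD]
    refine ⟨2, by norm_num, fun N x hN hx hNx => ?_⟩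
    have hNR : (N : ℝ) ≠ 0 := by positivity
    simp [errorBound, Real.rpow_neg_one, hNR]; norm_num
  · obtain rfl : D = -1 / 2 := by simp [hD]
    refine ⟨3 * (2 * Real.pi) ^ (1 / 4 : ℝ), by positivity, fun N x hN hx hNx => ?_⟩
    have hNR : (0 : ℝ) < N := by exact_mod_cast hN
    have h1 := sum_inv_sqrt_le N
    have h2 := rpow_le_of_sq_le (s := 1 / 4) hNR (by norm_num) (by linarith) hNx
    have e1 : errorBound (-1 / 2) x = x ^ (1 / 4 : ℝ) := by
      rw [errorBound, if_neg (by norm_num), if_pos rfl]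
    rw [Real.sqrt_eq_rpow] at h1
    rw [e1, show (-2 * (-1 / 2 : ℝ) - 1) = 0 by norm_num, Real.rpow_zero, one_mul,
      show -(-1 / 2 : ℝ) = 1 / 2 by norm_num]
    rw [show (2 * (1 / 4) : ℝ) = 1 / 2 by norm_num] at h2
    linarith
  · obtain rfl : D = -1 := by rw [hD]; norm_num
    refine ⟨3 * (2 * Real.pi) ^ (1 / 2 : ℝ), by positivity, fun N x hN hx hNx => ?_⟩
    have hNR : (0 : ℝ) < N := by exact_mod_cast hN
    have hx0 : 0 < x := by linarith
    have h2 := rpow_le_of_sq_le (s := 1 / 2) hNR (by norm_num) (by linarith) hNx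
    have e1 : errorBound (-1) x = x ^ (1 / 2 : ℝ) * Real.log x := by
      rw [errorBound, if_neg (by norm_num), if_neg (by norm_num), if_pos rfl,
        if_pos (by linarith)]
    have h3 := harmonic_le_one_add_log N
    have h4 : ∑ k ∈ Icc 1 N, (k : ℝ) ^ (-1 : ℝ) = ((harmonic N : ℚ) : ℝ) := by
      rw [harmonic_eq_sum_Icc]; push_cast
      exact sum_congr rfl fun k _ => Real.rpow_neg_one _
    -- `N² ≤ 2πx ≤ 8x ≤ x²`; together with `log x ≥ 1` this is the use of `8 ≤ x`.
    have h5 : Real.log N ≤ Real.log x := by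
      refine Real.log_le_log hNR ?_
      have : Real.pi ≤ 4 := Real.pi_le_four
      nlinarith
    have h6 : 1 ≤ Real.log x := by
      rw [Real.le_log_iff_exp_le hx0]
      have := Real.exp_one_lt_d9
      linarith
    rw [show (2 * (1 / 2) : ℝ) = 1 by norm_num, Real.rpow_one] at h2
    rw [e1, show (-2 * (-1 : ℝ) - 1) = 1 by norm_num, show -(-1 : ℝ) = 1 by norm_num,
      Real.rpow_one, h4]
    calc (N : ℝ) + N * (harmonic N : ℚ) ≤ N + N * (1 + Real.log N) := by gcongr
      _ = N * (2 + Real.log N) := by ring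
      _ ≤ ((2 * Real.pi) ^ (1 / 2 : ℝ) * x ^ (1 / 2 : ℝ)) * (3 * Real.log x) := by
        have : 0 ≤ Real.log N := Real.log_natCast_nonneg N
        gcongr; linarith
      _ = _ := by ring
  · have hSR : (3 : ℝ) ≤ S := by exact_mod_cast hS
    have hD3 : D ≤ -3 / 2 := by rw [hD]; linarith
    have hsum : Summable fun k : ℕ => (k : ℝ) ^ D := Real.summable_nat_rpow.2 (by linarith)
    have hT0 : 0 ≤ ∑' k : ℕ, (k : ℝ) ^ D := tsum_nonneg fun k => by positivity
    refine ⟨(1 + ∑' k : ℕ, (k : ℝ) ^ D) * (2 * Real.pi) ^ (-D - 1 / 2), by positivity,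
      fun N x hN hx hNx => ?_⟩
    have hNR : (0 : ℝ) < N := by exact_mod_cast hN
    have hN1 : (1 : ℝ) ≤ N := by exact_mod_cast hN
    have h2 := rpow_le_of_sq_le (s := -D - 1 / 2) hNR (by linarith) (by linarith) hNx
    rw [show 2 * (-D - 1 / 2) = -2 * D - 1 by ring] at h2
    have e1 : errorBound D x = x ^ (-D - 1 / 2) := by
      rw [errorBound, if_neg (by linarith), if_neg (by linarith), if_neg (by linarith)]
    have h3 : ∑ k ∈ Icc 1 N, (k : ℝ) ^ D ≤ ∑' k : ℕ, (k : ℝ) ^ D :=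
      hsum.sum_le_tsum _ fun k _ => by positivity
    have h4 : (N : ℝ) ^ (-D) ≤ (N : ℝ) ^ (-2 * D - 1) :=
      Real.rpow_le_rpow_of_exponent_le hN1 (by linarith)
    rw [e1]
    calc _ ≤ (N : ℝ) ^ (-2 * D - 1) + (N : ℝ) ^ (-2 * D - 1) * ∑' k : ℕ, (k : ℝ) ^ D := by gcongr
      _ = (1 + ∑' k : ℕ, (k : ℝ) ^ D) * (N : ℝ) ^ (-2 * D - 1) := by ring
      _ ≤ (1 + ∑' k : ℕ, (k : ℝ) ^ D) * ((2 * Real.pi) ^ (-D - 1 / 2) * x ^ (-D - 1 / 2)) := by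
        gcongr
      _ = _ := by ring

/-- Strict positivity allows the finitely many small `n` to be absorbed into the constant. -/
lemma errorBound_pos (D : ℝ) {x : ℝ} (hx : 0 < x) : 0 < errorBound D x := by
  unfold errorBound
  split_ifs with h1 h2 h3 h4
  · exact one_pos
  · positivity
  · exact mul_pos (by positivity) (Real.log_pos h4)
  · exact one_pos
  · positivity

lemma exists_Delta1_eq (hΔ : Delta1 δ ≤ 0) : ∃ S : ℕ, Delta1 δ = -(S : ℝ) / 2 := by
  have h1 : Delta1 δ = -((∑ r, δ r : ℤ) : ℝ) / 2 := by rw [Delta1]; push_cast; ring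
  have h2 : (0 : ℤ) ≤ ∑ r, δ r := by
    have : (0 : ℝ) ≤ ((∑ r, δ r : ℤ) : ℝ) := by linarith
    exact_mod_cast this
  obtain ⟨S, hS⟩ := Int.eq_ofNat_of_zero_le h2
  exact ⟨S, by rw [h1, hS]; simp⟩

/-- The upper bound for `2πx` holds because `√(2πx) < N + 1 ≤ 2N` once `N ≥ 1`. -/
lemma cutoff_bounds {n : ℕ} (hx : 8 ≤ shifted m δ n) : 0 < cutoff m δ n ∧
    (cutoff m δ n : ℝ) ^ 2 ≤ 2 * Real.pi * shifted m δ n ∧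
    2 * Real.pi * shifted m δ n ≤ 4 * (cutoff m δ n : ℝ) ^ 2 := by
  have hpi := Real.pi_gt_three
  have hX : 1 ≤ 2 * Real.pi * shifted m δ n := by nlinarith
  have h0 : 0 < cutoff m δ n := by
    rw [cutoff, Nat.floor_pos]
    exact Real.one_le_sqrt.2 hX
  have h1 : (cutoff m δ n : ℝ) ≤ Real.sqrt (2 * Real.pi * shifted m δ n) :=
    Nat.floor_le (Real.sqrt_nonneg _)
  have h2 : Real.sqrt (2 * Real.pi * shifted m δ n) < cutoff m δ n + 1 := Nat.lt_floor_add_one _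
  have h3 := Real.sq_sqrt (show 0 ≤ 2 * Real.pi * shifted m δ n by linarith)
  have h4 : (1 : ℝ) ≤ cutoff m δ n := by exact_mod_cast h0
  have h5 := Real.sqrt_nonneg (2 * Real.pi * shifted m δ n)
  refine ⟨h0, ?_, ?_⟩ <;> rw [← h3]
  · gcongr
  · nlinarith

end EtaQuotient

theorem theorem1p1 {R : ℕ} (m : Fin R → ℕ) (δ : Fin R → ℤ)
    (hm : ∀ r, 0 < m r) (hm_inj : Function.Injective m) (hδ : ∀ r, δ r ≠ 0)
    (hΔ : EtaQuotient.Delta1 δ ≤ 0)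
    (hmin : ∀ ℓ : ℕ, 1 ≤ ℓ → ℓ ≤ EtaQuotient.lcmL m → ∀ r : Fin R,
      EtaQuotient.Delta3 m δ ℓ / 24 ≤ ((m r).gcd ℓ : ℝ) ^ 2 / (m r : ℝ)) :
    ∃ E : ℕ → ℂ,
      (∀ n : ℕ, 0 < n → -EtaQuotient.Delta2 m δ / 24 < (n : ℝ) →
        EtaQuotient.g m δ n = E n + EtaQuotient.mainTerm m δ n) ∧
      ∃ C : ℝ, ∀ n : ℕ, 0 < n → -EtaQuotient.Delta2 m δ / 24 < (n : ℝ) →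
        ‖E n‖ ≤ C * EtaQuotient.errorBound (EtaQuotient.Delta1 δ)
          (EtaQuotient.shifted m δ n) := by
  refine ⟨fun n => EtaQuotient.g m δ n - EtaQuotient.mainTerm m δ n, fun n _ _ => by ring, ?_⟩
  obtain ⟨C₁, hC₁0, hC₁⟩ := EtaQuotient.exists_norm_g_sub_mainTerm_le hm hΔ hmin
  obtain ⟨S, hS⟩ := EtaQuotient.exists_Delta1_eq hΔ
  obtain ⟨C₂, hC₂0, hC₂⟩ := EtaQuotient.exists_le_errorBound hS
  set e : ℕ → ℝ := fun n => ‖EtaQuotient.g m δ n - EtaQuotient.mainTerm m δ n‖ with he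
  set b : ℕ → ℝ := fun n => EtaQuotient.errorBound (EtaQuotient.Delta1 δ)
    (EtaQuotient.shifted m δ n) with hb
  -- `n < M` holds exactly when `n + Δ₂/24 < 8`; for these finitely many `n` the quotients of error
  -- by bound are added to the constant.
  set M : ℕ := ⌈8 - EtaQuotient.Delta2 m δ / 24⌉₊ with hM
  refine ⟨C₁ * C₂ + ∑ n ∈ range M, |e n / b n|, fun n _ hn => ?_⟩
  have hx : 0 < EtaQuotient.shifted m δ n := by rw [EtaQuotient.shifted]; linarith
  have hbn : 0 < b n := EtaQuotient.errorBound_pos _ hx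
  have hsum : 0 ≤ ∑ n ∈ range M, |e n / b n| := sum_nonneg fun _ _ => abs_nonneg _
  change e n ≤ (C₁ * C₂ + ∑ n ∈ range M, |e n / b n|) * b n
  rcases le_or_gt 8 (EtaQuotient.shifted m δ n) with h8 | h8
  · obtain ⟨h0, h1, h2⟩ := EtaQuotient.cutoff_bounds h8
    calc e n ≤ C₁ * _ := hC₁ n _ rfl h0 h1 h2
      _ ≤ C₁ * (C₂ * b n) := by gcongr; exact hC₂ _ _ h0 h8 h1
      _ ≤ _ := by nlinarith
  · have hnM : n ∈ range M := by
      rw [mem_range, hM, Nat.lt_ceil]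
      rw [EtaQuotient.shifted] at h8; linarith
    have h1 := single_le_sum (f := fun n => |e n / b n|) (fun _ _ => abs_nonneg _) hnM
    have h2 : e n = e n / b n * b n := by field_simp
    calc e n = e n / b n * b n := h2
      _ ≤ |e n / b n| * b n := by gcongr; exact le_abs_self _
      _ ≤ _ := by
        gcongr
        have : 0 ≤ C₁ * C₂ := by positivity
        linarith [h1]
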